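/- For $p\ge 1$ and a complex $d\times d$ matrix $B$, let $\|B\|_p=(\operatorname{tr}|B|^p)^{1/p}$ with $|B|=(B^*B)^{1/2}$ denote the Schatten $p$-norm. Suppose that $p=1$ or $p\ge 1.5$. (1) Let $(P_k)$ be a finite sequence of independent random positive-semidefinite complex $d\times d$ matrices with $\mathbb E\|P_k\|_{2p}^{2p}<\infty$ for each $k$. Then $\mathbb E\|\sum_k P_k\|_{2p}^{2p}<\infty$ and $$\Big(\mathbb E\big\|\sum_k P_k\big\|_{2p}^{2p}\Big)^{1/(2p)}\le\Big[\big\|\sum_k\mathbb E P_k\big\|_{2p}^{1/2}+\sqrt{4p-2}\,\Big(\sum_k\mathbb E\|P_k\|_{2p}^{2p}\Big)^{1/(4p)}\Big]^2 .$$ (2) Let $(Y_k)$ be a finite sequence of independent random Hermitian complex $d\times d$ matrices with $\mathbb E Y_k=0$ and $\mathbb E\|Y_k\|_{4p}^{4p}<\infty$ for each $k$. Then $\mathbb E\|\sum_k Y_k\|_{4p}^{4p}<\infty$ and $$\Big(\mathbb E\big\|\sum_k Y_k\big\|_{4p}^{4p}\Big)^{1/(4p)}\le\sqrt{4p-1}\,\Big\|\Big(\sum_k\mathbb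 E Y_k^2\Big)^{1/2}\Big\|_{4p}+(4p-1)\Big(\sum_k\mathbb E\|Y_k\|_{4p}^{4p}\Big)^{1/(4p)} .$$ -/

import Mathlib

open MeasureTheory ProbabilityTheory
open scoped MatrixOrder ComplexOrder

/-- The product σ-algebra on complex `d × d` matrices, generated by the entries. -/
noncomputable instance complexMatrixMeasurableSpace (d : ℕ) :
    MeasurableSpace (Matrix (Fin d) (Fin d) ℂ) :=
  (MeasurableSpace.pi : MeasurableSpace (Fin d → Fin d → ℂ))

/-- The entry σ-algebra is the Borel σ-algebra of the usual topology on matrices. -/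
instance complexMatrixBorelSpace (d : ℕ) :
    BorelSpace (Matrix (Fin d) (Fin d) ℂ) :=
  (inferInstance : BorelSpace (Fin d → Fin d → ℂ))

/-- The Schatten `p`-norm `‖B‖_p = (tr |B|^p)^(1/p)`, where `|B| = (B* B)^(1/2)`.
The trace is that of a positive semidefinite matrix, hence real; `.re` only changes its type. -/
noncomputable def schattenNorm {d : ℕ} (p : ℝ) (B : Matrix (Fin d) (Fin d) ℂ) : ℝ :=
  ((CFC.abs B ^ p).trace.re) ^ (1 / p)

/-- The expectation of a random matrix, taken entry by entry. -/
noncomputable def matrixExpectation {Ω : Type*} [MeasurableSpace Ω] (μ : Measure Ω) {d : ℕ}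
    (X : Ω → Matrix (Fin d) (Fin d) ℂ) : Matrix (Fin d) (Fin d) ℂ :=
  Matrix.of fun i j => ∫ ω, X ω i j ∂μ

/-! The proof is Stein's method of exchangeable pairs. Let `S = ∑ Z_k` be a sum of independent
Hermitian matrices, `g` the signed power of exponent `2p - 1`, so that `tr |S|^{2p} = ∑ tr Z_k
g(S)`. Replace one summand by an independent copy `Z_k'` and call the new sum `S_k`. Since `Z_k'` is
independent of `S`, subtracting `tr (E Z_k) g(S)` turns `Z_k` into `Z_k - Z_k'` in expectation, and
exchangeability of `(S, S_k)` gives `E tr (Z_k - Z_k') g(S) = ½ E tr (Z_k - Z_k')(g(S) - g(S_k))`. A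
mean value trace inequality bounds the right side by `(2p - 1)/2 · E tr (Z_k - Z_k')² |S|^{2p-2}`.
This is `integral_tracePow_sum_le`. It rests on a trapezoid bound that needs `x ^ (2p - 2)` to be
convex on the half line, or constant: hence `p = 1` or `p ≥ 3/2`.

For positive semidefinite summands, `(P - P')² ≤ 2(P² + P'²)` and Hölder bring in the moment of `∑
P_k²`. It is interpolated between `∑ E tr P_k^{2p}` and the moment of `S` (`tracePow_sum_sq_le`),
and the resulting self-bounding inequality is solved for the moment (`posSemidef_moment_le`).

For centered summands the estimate is used with `2p` in place of `p`. The drift term vanishes, `(Y -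
Y')²` averages to `Y² + E Y²`, and the moment of `∑ Y_k²` is controlled by the positive semidefinite
case (`isHermitian_moment_le`).

The trace inequalities are reduced to scalar ones: the squared overlaps of two eigenbases form a
doubly stochastic matrix, and the traces involved are sums against these weights. -/

/-! ### Traces as sums over pairs of eigenvalues. -/

section Spectral
variable {n : Type*} [Fintype n] [DecidableEq n]

/-- The squared overlaps of the eigenbases of two Hermitian matrices. -/
noncomputable def overlap {A B : Matrix n n ℂ} (hA : A.IsHermitian) (hB : B.IsHermitian)
    (i j : n) : ℝ :=
  Complex.normSq ((star (hA.eigenvectorUnitary : Matrix n n ℂ) * hB.eigenvectorUnitary) i j)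

lemma overlap_nonneg {A B : Matrix n n ℂ} (hA : A.IsHermitian) (hB : B.IsHermitian) (i j : n) :
    0 ≤ overlap hA hB i j := Complex.normSq_nonneg _

/-- Conjugating by the eigenbasis of `A` leaves only the unitary change of basis between the two
eigenbases, whose entries enter through their squared moduli. Noncommuting matrices are thereby
treated as scalars with nonnegative weights. -/
lemma trace_cfc_mul_cfc {A B : Matrix n n ℂ} (hA : A.IsHermitian) (hB : B.IsHermitian)
    (u v : ℝ → ℝ) :
    (cfc u A * cfc v B).trace =
      ((∑ i, ∑ j, overlap hA hB i j * (u (hA.eigenvalues i) * v (hB.eigenvalues j)) : ℝ) : ℂ) := by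
  rw [hA.cfc_eq, hB.cfc_eq, Matrix.IsHermitian.cfc, Matrix.IsHermitian.cfc,
    Unitary.conjStarAlgAut_apply, Unitary.conjStarAlgAut_apply]
  set U : Matrix n n ℂ := (hA.eigenvectorUnitary : Matrix n n ℂ)
  set V : Matrix n n ℂ := (hB.eigenvectorUnitary : Matrix n n ℂ)
  set D := Matrix.diagonal (RCLike.ofReal ∘ u ∘ hA.eigenvalues : n → ℂ)
  set E := Matrix.diagonal (RCLike.ofReal ∘ v ∘ hB.eigenvalues : n → ℂ)
  have h1 : (U * D * star U * (V * E * star V)).trace =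
      (D * (star U * V) * (E * star (star U * V))).trace := by
    rw [Matrix.mul_assoc U, Matrix.mul_assoc U, Matrix.trace_mul_comm]
    simp only [Matrix.mul_assoc, star_mul, star_star]
  rw [h1, Matrix.trace]
  simp only [Matrix.diag_apply, Matrix.mul_apply (M := D * _), D, E, Matrix.diagonal_mul,
    Function.comp_apply, Matrix.star_apply]
  push_cast
  refine Finset.sum_congr rfl fun i _ => Finset.sum_congr rfl fun j _ => ?_
  have : ((overlap hA hB i j : ℝ) : ℂ) = (star U * V) i j * star ((star U * V) i j) := by
    rw [overlap, ← Complex.mul_conj]; rfl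
  rw [this]
  simp only [Complex.coe_algebraMap]
  ring

lemma trace_cfc_mul_cfc_re {A B : Matrix n n ℂ} (hA : A.IsHermitian) (hB : B.IsHermitian)
    (u v : ℝ → ℝ) :
    (cfc u A * cfc v B).trace.re =
      ∑ i, ∑ j, overlap hA hB i j * (u (hA.eigenvalues i) * v (hB.eigenvalues j)) := by
  rw [trace_cfc_mul_cfc hA hB, Complex.ofReal_re]

/-- The change of basis is unitary, so its rows are unit vectors; with `sum_overlap_left` the
overlaps are doubly stochastic. -/
lemma sum_overlap_right {A B : Matrix n n ℂ} (hA : A.IsHermitian) (hB : B.IsHermitian) (i : n) :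
    ∑ j, overlap hA hB i j = 1 := by
  have h : (star (hA.eigenvectorUnitary : Matrix n n ℂ) * hB.eigenvectorUnitary) *
      star (star (hA.eigenvectorUnitary : Matrix n n ℂ) * hB.eigenvectorUnitary) = 1 := by
    rw [star_mul, star_star, Matrix.mul_assoc, ← Matrix.mul_assoc _ (star _),
      ← Unitary.coe_star, ← Unitary.coe_star, Unitary.coe_mul_star_self, Matrix.one_mul,
      Unitary.coe_star, Unitary.coe_star_mul_self]
  have h2 := congrFun (congrFun h i) i
  rw [Matrix.mul_apply, Matrix.one_apply_eq] at h2
  have h3 : ((∑ j, overlap hA hB i j : ℝ) : ℂ) = 1 := by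
    rw [← h2]
    push_cast
    refine Finset.sum_congr rfl fun j _ => ?_
    rw [overlap, ← Complex.mul_conj, Matrix.star_apply (M := _ * _)]; rfl
  exact_mod_cast h3

lemma overlap_comm {A B : Matrix n n ℂ} (hA : A.IsHermitian) (hB : B.IsHermitian) (i j : n) :
    overlap hA hB i j = overlap hB hA j i := by
  have : (star (hA.eigenvectorUnitary : Matrix n n ℂ) * hB.eigenvectorUnitary) =
      star (star (hB.eigenvectorUnitary : Matrix n n ℂ) * hA.eigenvectorUnitary) := by simp
  rw [overlap, overlap, this, Matrix.star_apply]
  exact Complex.normSq_conj _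

lemma sum_overlap_left {A B : Matrix n n ℂ} (hA : A.IsHermitian) (hB : B.IsHermitian) (j : n) :
    ∑ i, overlap hA hB i j = 1 := by
  simp_rw [overlap_comm hA hB]
  exact sum_overlap_right hB hA j

lemma trace_cfc {A : Matrix n n ℂ} (hA : A.IsHermitian) (u : ℝ → ℝ) :
    (cfc u A).trace.re = ∑ i, u (hA.eigenvalues i) := by
  have h := trace_cfc_mul_cfc_re hA hA u (fun _ => 1)
  rw [show cfc (fun _ : ℝ => (1 : ℝ)) A = 1 from cfc_const_one ℝ A (ha := hA), mul_one] at h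
  rw [h]
  refine Finset.sum_congr rfl fun i _ => ?_
  rw [← Finset.sum_mul, sum_overlap_right]; ring

/-- Puts a trace involving one matrix into the double-sum form, so that it can be compared term by
term with traces involving two. -/
lemma sum_overlap_mul_left {A B : Matrix n n ℂ} (hA : A.IsHermitian) (hB : B.IsHermitian)
    (u : ℝ → ℝ) :
    ∑ i, ∑ j, overlap hA hB i j * u (hA.eigenvalues i) = (cfc u A).trace.re := by
  rw [trace_cfc hA]
  refine Finset.sum_congr rfl fun i _ => ?_
  rw [← Finset.sum_mul, sum_overlap_right, one_mul]

lemma sum_overlap_mul_right {A B : Matrix n n ℂ} (hA : A.IsHermitian) (hB : B.IsHermitian)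
    (v : ℝ → ℝ) :
    ∑ i, ∑ j, overlap hA hB i j * v (hB.eigenvalues j) = (cfc v B).trace.re := by
  rw [trace_cfc hB, Finset.sum_comm]
  refine Finset.sum_congr rfl fun i _ => ?_
  rw [← Finset.sum_mul, sum_overlap_left, one_mul]

/-- `tr |A|^q` for a Hermitian matrix `A`. -/
noncomputable def tracePow (q : ℝ) (A : Matrix n n ℂ) : ℝ :=
  (cfc (fun x : ℝ => |x| ^ q) A).trace.re

lemma tracePow_eq {A : Matrix n n ℂ} (hA : A.IsHermitian) (q : ℝ) :
    tracePow q A = ∑ i, |hA.eigenvalues i| ^ q := trace_cfc hA _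

lemma tracePow_nonneg {A : Matrix n n ℂ} (hA : A.IsHermitian) (q : ℝ) : 0 ≤ tracePow q A := by
  rw [tracePow_eq hA]; positivity

end Spectral

/-! ### Scalar inequalities: Hölder and the trapezoid bound. -/

section Scalar

/-- Young's inequality after normalization: with `A` and `B` the total masses of the two factors,
summing or integrating it gives Hölder. -/
lemma weighted_young {A B : ℝ} (hA : 0 < A) (hB : 0 < B) {a b : ℝ} (ha : 0 ≤ a) (hb : 0 ≤ b)
    {s t : ℝ} (hs : 0 ≤ s) (ht : 0 ≤ t) (hst : s + t = 1) :
    a ^ s * b ^ t ≤ A ^ s * B ^ t * (s * (a / A) + t * (b / B)) := by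
  have h := Real.geom_mean_le_arith_mean2_weighted hs ht (div_nonneg ha hA.le)
    (div_nonneg hb hB.le) hst
  rw [Real.div_rpow ha hA.le, Real.div_rpow hb hB.le, div_mul_div_comm,
    div_le_iff₀ (by positivity)] at h
  linarith

lemma rpow_mul_rpow_le_add {a b : ℝ} (ha : 0 ≤ a) (hb : 0 ≤ b)
    {s t : ℝ} (hs : 0 ≤ s) (ht : 0 ≤ t) (hst : s + t = 1) : a ^ s * b ^ t ≤ a + b := by
  have h := Real.geom_mean_le_arith_mean2_weighted hs ht ha hb hst
  nlinarith

/-- Hölder's inequality with exponents that sum to one. -/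
lemma integral_rpow_mul_rpow_le {Ω : Type*} [MeasurableSpace Ω] {μ : Measure Ω} {F G : Ω → ℝ}
    (hF : Integrable F μ) (hG : Integrable G μ) (hF0 : 0 ≤ F) (hG0 : 0 ≤ G)
    {s t : ℝ} (hs : 0 ≤ s) (ht : 0 ≤ t) (hst : s + t = 1) :
    ∫ ω, F ω ^ s * G ω ^ t ∂μ ≤ (∫ ω, F ω ∂μ) ^ s * (∫ ω, G ω ∂μ) ^ t := by
  rcases hs.eq_or_lt with rfl | hs
  · simp [show t = 1 by linarith]
  -- The endpoint `t = 0` does occur later, as the exponent `(p - 1) / p` at `p = 1`.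
  rcases ht.eq_or_lt with rfl | ht
  · simp [show s = 1 by linarith]
  rcases (integral_nonneg hF0 : 0 ≤ ∫ ω, F ω ∂μ).eq_or_lt with h0 | hA
  · rw [← h0, Real.zero_rpow hs.ne', zero_mul]
    have := (integral_eq_zero_iff_of_nonneg hF0 hF).1 h0.symm
    refine (integral_eq_zero_of_ae ?_).le
    filter_upwards [this] with ω hω
    simp [hω, Real.zero_rpow hs.ne']
  rcases (integral_nonneg hG0 : 0 ≤ ∫ ω, G ω ∂μ).eq_or_lt with h0 | hB
  · rw [← h0, Real.zero_rpow ht.ne', mul_zero]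
    have := (integral_eq_zero_iff_of_nonneg hG0 hG).1 h0.symm
    refine (integral_eq_zero_of_ae ?_).le
    filter_upwards [this] with ω hω
    simp [hω, Real.zero_rpow ht.ne']
  set A := ∫ ω, F ω ∂μ
  set B := ∫ ω, G ω ∂μ
  calc ∫ ω, F ω ^ s * G ω ^ t ∂μ
      ≤ ∫ ω, A ^ s * B ^ t * (s * (F ω / A) + t * (G ω / B)) ∂μ := by
        refine integral_mono_of_nonneg (Filter.Eventually.of_forall fun ω =>
          mul_nonneg (Real.rpow_nonneg (hF0 ω) _) (Real.rpow_nonneg (hG0 ω) _)) ?_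
          (Filter.Eventually.of_forall fun ω =>
            weighted_young hA hB (hF0 ω) (hG0 ω) hs.le ht.le hst)
        exact (((hF.div_const A).const_mul s).add ((hG.div_const B).const_mul t)).const_mul _
    _ = A ^ s * B ^ t := by
        rw [integral_const_mul, integral_add ((hF.div_const A).const_mul s)
          ((hG.div_const B).const_mul t), integral_const_mul, integral_const_mul,
          integral_div, integral_div, div_self hA.ne', div_self hB.ne', mul_one, mul_one, hst,
          mul_one]

lemma sum_rpow_mul_rpow_le {κ : Type*} (I : Finset κ) {w F G : κ → ℝ}
    (hw : ∀ i ∈ I, 0 ≤ w i) (hF : ∀ i ∈ I, 0 ≤ F i) (hG : ∀ i ∈ I, 0 ≤ G i)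
    {s t : ℝ} (hs : 0 ≤ s) (ht : 0 ≤ t) (hst : s + t = 1) :
    ∑ i ∈ I, w i * (F i ^ s * G i ^ t) ≤
      (∑ i ∈ I, w i * F i) ^ s * (∑ i ∈ I, w i * G i) ^ t := by
  rcases hs.eq_or_lt with rfl | hs
  · simp [show t = 1 by linarith]
  rcases ht.eq_or_lt with rfl | ht
  · simp [show s = 1 by linarith]
  have hA : 0 ≤ ∑ i ∈ I, w i * F i := Finset.sum_nonneg fun i hi => mul_nonneg (hw i hi) (hF i hi)
  have hB : 0 ≤ ∑ i ∈ I, w i * G i := Finset.sum_nonneg fun i hi => mul_nonneg (hw i hi) (hG i hi)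
  rcases hA.eq_or_lt with h0 | hA
  · rw [← h0, Real.zero_rpow hs.ne', zero_mul]
    refine (Finset.sum_eq_zero fun i hi => ?_).le
    rcases mul_eq_zero.1 ((Finset.sum_eq_zero_iff_of_nonneg
      fun i hi => mul_nonneg (hw i hi) (hF i hi)).1 h0.symm i hi) with h | h
    · simp [h]
    · simp [h, Real.zero_rpow hs.ne']
  rcases hB.eq_or_lt with h0 | hB
  · rw [← h0, Real.zero_rpow ht.ne', mul_zero]
    refine (Finset.sum_eq_zero fun i hi => ?_).le
    rcases mul_eq_zero.1 ((Finset.sum_eq_zero_iff_of_nonneg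
      fun i hi => mul_nonneg (hw i hi) (hG i hi)).1 h0.symm i hi) with h | h
    · simp [h]
    · simp [h, Real.zero_rpow ht.ne']
  set A := ∑ i ∈ I, w i * F i with hAd
  set B := ∑ i ∈ I, w i * G i with hBd
  calc ∑ i ∈ I, w i * (F i ^ s * G i ^ t)
      ≤ ∑ i ∈ I, w i * (A ^ s * B ^ t * (s * (F i / A) + t * (G i / B))) :=
        Finset.sum_le_sum fun i hi => mul_le_mul_of_nonneg_left
          (weighted_young hA hB (hF i hi) (hG i hi) hs.le ht.le hst) (hw i hi)
    _ = A ^ s * B ^ t * (s / A * A + t / B * B) := by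
        nth_rewrite 4 [hBd]
        nth_rewrite 3 [hAd]
        rw [Finset.mul_sum, Finset.mul_sum, ← Finset.sum_add_distrib, Finset.mul_sum]
        refine Finset.sum_congr rfl fun i _ => by ring
    _ = A ^ s * B ^ t := by
        rw [div_mul_cancel₀ _ hA.ne', div_mul_cancel₀ _ hB.ne', hst, mul_one]

/-- The odd extension of the `s`-th power to the real line. -/
noncomputable def signedPow (s x : ℝ) : ℝ := SignType.sign x * |x| ^ s

lemma signedPow_neg (s x : ℝ) : signedPow s (-x) = -signedPow s x := by
  simp [signedPow, Left.sign_neg]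

lemma signedPow_of_nonneg {s x : ℝ} (hs : s ≠ 0) (hx : 0 ≤ x) : signedPow s x = x ^ s := by
  rcases hx.eq_or_lt with rfl | hx
  · simp [signedPow, Real.zero_rpow hs]
  · simp [signedPow, sign_pos hx, abs_of_pos hx]

lemma mul_signedPow {s : ℝ} (hs : 0 < s) (x : ℝ) : x * signedPow s x = |x| ^ (s + 1) := by
  rcases eq_or_ne x 0 with rfl | hx
  · simp [Real.zero_rpow (by linarith : s + 1 ≠ 0)]
  · rw [signedPow, ← mul_assoc, self_mul_sign, Real.rpow_add_one (abs_ne_zero.2 hx), mul_comm]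

lemma abs_signedPow {s : ℝ} (hs : 0 < s) (x : ℝ) : |signedPow s x| = |x| ^ s := by
  rcases eq_or_ne x 0 with rfl | hx
  · simp [signedPow, Real.zero_rpow hs.ne']
  · rw [signedPow, abs_mul, abs_of_nonneg (Real.rpow_nonneg (abs_nonneg x) s)]
    rcases hx.lt_or_gt with h | h <;> simp [h]

lemma continuous_signedPow {s : ℝ} (hs : 0 < s) : Continuous (signedPow s) := by
  have : signedPow s = fun x => (max x 0) ^ s - (max (-x) 0) ^ s := by
    funext x
    rcases le_total 0 x with h | h
    · rw [signedPow_of_nonneg hs.ne' h, max_eq_left h, max_eq_right (by linarith),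
        Real.zero_rpow hs.ne', sub_zero]
    · rw [← neg_neg x, signedPow_neg, signedPow_of_nonneg hs.ne' (by linarith), neg_neg,
        max_eq_right h, max_eq_left (by linarith), Real.zero_rpow hs.ne', zero_sub]
  rw [this]
  exact ((continuous_id.max continuous_const).rpow_const fun _ => Or.inr hs.le).sub
    ((continuous_neg.max continuous_const).rpow_const fun _ => Or.inr hs.le)

/-- The trapezoid bound for the convex function `s * x ^ (s - 1)` on the half line. -/
lemma rpow_sub_rpow_le_trapezoid {s : ℝ} (hs : 2 ≤ s) {a b : ℝ} (hb : 0 ≤ b) (hab : b ≤ a) :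
    a ^ s - b ^ s ≤ s / 2 * (a - b) * (a ^ (s - 1) + b ^ (s - 1)) := by
  let φ : ℝ → ℝ := fun x => s / 2 * (x - b) * (x ^ (s - 1) + b ^ (s - 1)) - (x ^ s - b ^ s)
  have hder : ∀ x, HasDerivAt φ (s / 2 * 1 * (x ^ (s - 1) + b ^ (s - 1)) +
      s / 2 * (x - b) * ((s - 1) * x ^ (s - 1 - 1)) - s * x ^ (s - 1)) x := fun x =>
    ((((hasDerivAt_id x).sub_const b).const_mul (s / 2)).mul
      ((Real.hasDerivAt_rpow_const (Or.inr (by linarith))).add_const _)).sub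
      ((Real.hasDerivAt_rpow_const (Or.inr (by linarith))).sub_const _)
  have hmono : MonotoneOn φ (Set.Ici b) := by
    refine monotoneOn_of_deriv_nonneg (convex_Ici b)
      (fun x _ => (hder x).continuousAt.continuousWithinAt)
      (fun x _ => (hder x).differentiableAt.differentiableWithinAt) fun x hx => ?_
    rw [interior_Ici, Set.mem_Ioi] at hx
    rw [(hder x).deriv]
    have hx0 : 0 < x := hb.trans_lt hx
    -- The derivative is nonnegative because the convex function `t ^ (s - 1)` lies above its
    -- tangent at `x`; evaluated at `b`, this is Bernoulli's inequality for `b / x`.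
    have hbern := one_add_mul_self_le_rpow_one_add (s := b / x - 1)
      (by have := div_nonneg hb hx0.le; linarith) (p := s - 1) (by linarith)
    rw [add_sub_cancel, Real.div_rpow hb hx0.le, le_div_iff₀ (by positivity)] at hbern
    have hx1 : x ^ (s - 1) = x ^ (s - 1 - 1) * x := by
      rw [← Real.rpow_add_one hx0.ne']; ring_nf
    have h2 : (1 + (s - 1) * (b / x - 1)) * x ^ (s - 1) =
        x ^ (s - 1) + (s - 1) * (b - x) * x ^ (s - 1 - 1) := by
      rw [hx1]; field_simp
    rw [h2] at hbern
    nlinarith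
  have := hmono Set.self_mem_Ici (Set.mem_Ici.2 hab) hab
  simp only [φ, sub_self, mul_zero, zero_mul] at this
  linarith

/-- The derivative of `signedPow s` is `s * |x| ^ (s - 1)`. For `s = 1` it is constant and equality
holds; for `s ≥ 2` it is convex, and the trapezoid rule overestimates its integral. -/
lemma sub_mul_signedPow_sub_le {s : ℝ} (hs : s = 1 ∨ 2 ≤ s) (a b : ℝ) :
    (a - b) * (signedPow s a - signedPow s b) ≤
      s / 2 * ((a - b) ^ 2 * (|a| ^ (s - 1) + |b| ^ (s - 1))) := by
  rcases hs with rfl | hs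
  · simp only [signedPow, Real.rpow_one, sign_mul_abs, sub_self, Real.rpow_zero]
    exact le_of_eq (by ring)
  have hs0 : s ≠ 0 := by linarith
  wlog hab : b ≤ a generalizing a b
  · have := this b a (by linarith)
    nlinarith
  have key : signedPow s a - signedPow s b ≤
      s / 2 * (a - b) * (|a| ^ (s - 1) + |b| ^ (s - 1)) := by
    rcases le_total 0 b with hb | hb
    · have ha := hb.trans hab
      rw [signedPow_of_nonneg hs0 ha, signedPow_of_nonneg hs0 hb, abs_of_nonneg ha,
        abs_of_nonneg hb]
      exact rpow_sub_rpow_le_trapezoid hs hb hab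
    have hb' : signedPow s b = -(-b) ^ s := by
      rw [← signedPow_of_nonneg hs0 (by linarith : 0 ≤ -b), signedPow_neg, neg_neg]
    rcases le_total 0 a with ha | ha
    · rw [signedPow_of_nonneg hs0 ha, hb', abs_of_nonneg ha, abs_of_nonpos hb]
      -- For opposite signs convexity is not needed: `a x + (-b) y ≤ (a - b)(x + y)` with `x = a ^
      -- (s - 1)` and `y = (-b) ^ (s - 1)`, and `s / 2 ≥ 1`.
      have h1 : ∀ x : ℝ, 0 ≤ x → x ^ s = x * x ^ (s - 1) := fun x hx => by
        rcases hx.eq_or_lt with rfl | hx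
        · simp [Real.zero_rpow hs0]
        · rw [mul_comm, ← Real.rpow_add_one hx.ne', sub_add_cancel]
      rw [h1 a ha, h1 (-b) (by linarith)]
      have p1 := Real.rpow_nonneg ha (s - 1)
      have p2 := Real.rpow_nonneg (by linarith : 0 ≤ -b) (s - 1)
      set x := a ^ (s - 1)
      set y := (-b) ^ (s - 1)
      have : 0 ≤ (s / 2 - 1) * ((a - b) * (x + y)) :=
        mul_nonneg (by linarith) (mul_nonneg (by linarith) (by linarith))
      nlinarith [mul_nonneg ha p2, mul_nonneg (by linarith : 0 ≤ -b) p1]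
    · have ha' : signedPow s a = -(-a) ^ s := by
        rw [← signedPow_of_nonneg hs0 (by linarith : 0 ≤ -a), signedPow_neg, neg_neg]
      rw [ha', hb', abs_of_nonpos ha, abs_of_nonpos hb]
      have := rpow_sub_rpow_le_trapezoid hs (by linarith : 0 ≤ -a) (by linarith : -a ≤ -b)
      nlinarith
  calc _ ≤ (a - b) * (s / 2 * (a - b) * (|a| ^ (s - 1) + |b| ^ (s - 1))) :=
        mul_le_mul_of_nonneg_left key (by linarith)
    _ = _ := by ring

end Scalar

/-! ### Trace inequalities for Hermitian matrices. -/

section Trace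
variable {n : Type*} [Fintype n] [DecidableEq n]

/-- The spectrum is finite, so every function is admissible in the functional calculus. -/
lemma Matrix.continuousOn_real_spectrum (A : Matrix n n ℂ) (u : ℝ → ℝ) :
    ContinuousOn u (spectrum ℝ A) :=
  (Matrix.finite_real_spectrum (A := A)).continuousOn u

lemma Matrix.cfc_mul_cfc {A : Matrix n n ℂ} (u v : ℝ → ℝ) :
    cfc u A * cfc v A = cfc (fun x => u x * v x) A :=
  (cfc_mul u v A (A.continuousOn_real_spectrum u) (A.continuousOn_real_spectrum v)).symm

lemma Matrix.IsHermitian.cfc_id_eq {A : Matrix n n ℂ} (hA : A.IsHermitian) :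
    cfc (fun x : ℝ => x) A = A := cfc_id' ℝ A (ha := hA)

lemma trace_mul_cfc_re {A B : Matrix n n ℂ} (hA : A.IsHermitian) (hB : B.IsHermitian)
    (v : ℝ → ℝ) :
    (A * cfc v B).trace.re =
      ∑ i, ∑ j, overlap hA hB i j * (hA.eigenvalues i * v (hB.eigenvalues j)) := by
  have := trace_cfc_mul_cfc_re hA hB (fun x => x) v
  rwa [hA.cfc_id_eq] at this

lemma trace_self_mul_cfc_re {A B : Matrix n n ℂ} (hA : A.IsHermitian) (hB : B.IsHermitian)
    (u : ℝ → ℝ) :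
    (A * cfc u A).trace.re =
      ∑ i, ∑ j, overlap hA hB i j * (hA.eigenvalues i * u (hA.eigenvalues i)) := by
  rw [sum_overlap_mul_left hA hB (fun x => x * u x), ← Matrix.cfc_mul_cfc (fun x => x),
    hA.cfc_id_eq]

/-- Although `(A - B) ^ 2` is diagonal in neither eigenbasis, cyclicity of the trace and the
commutation of `A` with `u(A)` reduce each of the four products to a function of `A` times a
function of `B`. -/
lemma trace_sub_sq_mul_cfc_left {A B : Matrix n n ℂ} (hA : A.IsHermitian) (hB : B.IsHermitian)
    (u : ℝ → ℝ) :
    ((A - B) ^ 2 * cfc u A).trace.re = ∑ i, ∑ j, overlap hA hB i j *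
      ((hA.eigenvalues i - hB.eigenvalues j) ^ 2 * u (hA.eigenvalues i)) := by
  have hAu : A * cfc u A = cfc (fun x => x * u x) A := by
    rw [← Matrix.cfc_mul_cfc (fun x => x), hA.cfc_id_eq]
  have huA : cfc u A * A = cfc (fun x => x * u x) A := by
    nth_rewrite 2 [← hA.cfc_id_eq]
    rw [Matrix.cfc_mul_cfc]
    simp only [mul_comm]
  have h1 : (A * A * cfc u A).trace.re = ∑ i, ∑ j, overlap hA hB i j *
      (hA.eigenvalues i ^ 2 * u (hA.eigenvalues i)) := by
    rw [Matrix.mul_assoc, hAu, trace_self_mul_cfc_re hA hB]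
    simp only [sq, mul_assoc]
  have h2 : (A * B * cfc u A).trace.re = ∑ i, ∑ j, overlap hA hB i j *
      (hA.eigenvalues i * hB.eigenvalues j * u (hA.eigenvalues i)) := by
    rw [Matrix.mul_assoc, Matrix.trace_mul_comm, Matrix.mul_assoc, huA, trace_mul_cfc_re hB hA,
      Finset.sum_comm]
    refine Finset.sum_congr rfl fun i _ => Finset.sum_congr rfl fun j _ => ?_
    rw [overlap_comm hB hA]; ring
  have h3 : (B * A * cfc u A).trace.re = ∑ i, ∑ j, overlap hA hB i j *
      (hA.eigenvalues i * hB.eigenvalues j * u (hA.eigenvalues i)) := by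
    rw [Matrix.mul_assoc, hAu, trace_mul_cfc_re hB hA, Finset.sum_comm]
    refine Finset.sum_congr rfl fun i _ => Finset.sum_congr rfl fun j _ => ?_
    rw [overlap_comm hB hA]; ring
  have h4 : (B * B * cfc u A).trace.re = ∑ i, ∑ j, overlap hA hB i j *
      (hB.eigenvalues j ^ 2 * u (hA.eigenvalues i)) := by
    have hBB : B * B = cfc (fun x : ℝ => x * x) B := by
      rw [← Matrix.cfc_mul_cfc (fun x => x), hB.cfc_id_eq]
    rw [hBB, trace_cfc_mul_cfc_re hB hA, Finset.sum_comm]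
    refine Finset.sum_congr rfl fun i _ => Finset.sum_congr rfl fun j _ => ?_
    rw [overlap_comm hB hA]; ring
  have hexp : (A - B) ^ 2 * cfc u A =
      A * A * cfc u A - A * B * cfc u A - B * A * cfc u A + B * B * cfc u A := by
    noncomm_ring
  rw [hexp, Matrix.trace_add, Matrix.trace_sub, Matrix.trace_sub, Complex.add_re, Complex.sub_re,
    Complex.sub_re, h1, h2, h3, h4]
  simp only [← Finset.sum_sub_distrib, ← Finset.sum_add_distrib]
  refine Finset.sum_congr rfl fun i _ => Finset.sum_congr rfl fun j _ => by ring

/-- The mean value trace inequality for signed powers. -/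
lemma trace_sub_mul_signedPow_sub_le {A B : Matrix n n ℂ} (hA : A.IsHermitian)
    (hB : B.IsHermitian) {s : ℝ} (hs : s = 1 ∨ 2 ≤ s) :
    ((A - B) * (cfc (signedPow s) A - cfc (signedPow s) B)).trace.re ≤
      s / 2 * (((A - B) ^ 2 * cfc (fun x : ℝ => |x| ^ (s - 1)) A).trace.re +
        ((A - B) ^ 2 * cfc (fun x : ℝ => |x| ^ (s - 1)) B).trace.re) := by
  have hexp : (A - B) * (cfc (signedPow s) A - cfc (signedPow s) B) =
      A * cfc (signedPow s) A - A * cfc (signedPow s) B - B * cfc (signedPow s) A +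
        B * cfc (signedPow s) B := by
    noncomm_ring
  have hsq : (A - B) ^ 2 = (B - A) ^ 2 := by noncomm_ring
  rw [hexp, Matrix.trace_add, Matrix.trace_sub, Matrix.trace_sub, Complex.add_re, Complex.sub_re,
    Complex.sub_re, trace_sub_sq_mul_cfc_left hA hB, hsq, trace_sub_sq_mul_cfc_left hB hA,
    trace_self_mul_cfc_re hA hB, trace_self_mul_cfc_re hB hA, trace_mul_cfc_re hA hB,
    trace_mul_cfc_re hB hA,
    Finset.sum_comm (f := fun i j => overlap hB hA i j * (_ * signedPow s (hA.eigenvalues j))),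
    Finset.sum_comm (f := fun i j => overlap hB hA i j * (_ * signedPow s (hB.eigenvalues i))),
    Finset.sum_comm (f := fun i j => overlap hB hA i j * (_ * |hB.eigenvalues i| ^ (s - 1)))]
  simp only [← Finset.sum_sub_distrib, ← Finset.sum_add_distrib, Finset.mul_sum]
  -- All sums now run over the same pairs of eigenvalues; the scalar inequality is applied to each
  -- pair and weighted by the overlap.
  refine Finset.sum_le_sum fun i _ => Finset.sum_le_sum fun j _ => ?_
  rw [overlap_comm hB hA]
  have := mul_le_mul_of_nonneg_left
    (sub_mul_signedPow_sub_le hs (hA.eigenvalues i) (hB.eigenvalues j)) (overlap_nonneg hA hB i j)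
  calc _ = overlap hA hB i j * ((hA.eigenvalues i - hB.eigenvalues j) *
        (signedPow s (hA.eigenvalues i) - signedPow s (hB.eigenvalues j))) := by ring
    _ ≤ _ := this
    _ = _ := by ring

/-- Hölder's inequality for traces of functions of two Hermitian matrices. -/
lemma abs_trace_cfc_mul_cfc_le {A B : Matrix n n ℂ} (hA : A.IsHermitian) (hB : B.IsHermitian)
    {u v F G : ℝ → ℝ} {s t : ℝ} (hs : 0 ≤ s) (ht : 0 ≤ t) (hst : s + t = 1)
    (hF : ∀ x, 0 ≤ F x) (hG : ∀ x, 0 ≤ G x)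
    (hu : ∀ x, |u x| ≤ F x ^ s) (hv : ∀ x, |v x| ≤ G x ^ t) :
    |(cfc u A * cfc v B).trace.re| ≤ (cfc F A).trace.re ^ s * (cfc G B).trace.re ^ t := by
  rw [trace_cfc_mul_cfc_re hA hB, ← sum_overlap_mul_left hA hB F, ← sum_overlap_mul_right hA hB G]
  simp only [← Finset.sum_product']
  refine (Finset.abs_sum_le_sum_abs _ _).trans ?_
  refine le_trans (Finset.sum_le_sum fun x _ => ?_) (sum_rpow_mul_rpow_le _
    (fun x _ => overlap_nonneg hA hB x.1 x.2) (fun x _ => hF _) (fun x _ => hG _) hs ht hst)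
  rw [abs_mul, abs_mul, abs_of_nonneg (overlap_nonneg hA hB x.1 x.2)]
  exact mul_le_mul_of_nonneg_left (mul_le_mul (hu _) (hv _) (abs_nonneg _)
    (Real.rpow_nonneg (hF _) _)) (overlap_nonneg hA hB x.1 x.2)

/-- Gives monotonicity: an inequality between squares survives multiplication by a nonnegative
function of `B` under the trace. -/
lemma trace_sq_mul_cfc_nonneg {H B : Matrix n n ℂ} (hH : H.IsHermitian) (hB : B.IsHermitian)
    {v : ℝ → ℝ} (hv : ∀ x, 0 ≤ v x) : 0 ≤ (H ^ 2 * cfc v B).trace.re := by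
  have : H ^ 2 = cfc (fun x : ℝ => x * x) H := by
    rw [← Matrix.cfc_mul_cfc (fun x => x), hH.cfc_id_eq, sq]
  rw [this, trace_cfc_mul_cfc_re hH hB]
  exact Finset.sum_nonneg fun i _ => Finset.sum_nonneg fun j _ =>
    mul_nonneg (overlap_nonneg _ _ _ _) (mul_nonneg (mul_self_nonneg _) (hv _))

/-! ### Diagonals in an eigenbasis and sums of matrices. -/

/-- The real parts of the diagonal entries of `A` in the eigenbasis of `B`. -/
noncomputable def eigenbasisDiag {B : Matrix n n ℂ} (hB : B.IsHermitian) (j : n) :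
    Matrix n n ℂ →+ ℝ where
  toFun A := ((star (hB.eigenvectorUnitary : Matrix n n ℂ) * A * hB.eigenvectorUnitary) j j).re
  map_zero' := by simp
  map_add' A A' := by simp [Matrix.mul_add, Matrix.add_mul]

lemma eigenbasisDiag_cfc {A B : Matrix n n ℂ} (hB : B.IsHermitian) (hA : A.IsHermitian)
    (u : ℝ → ℝ) (j : n) :
    eigenbasisDiag hB j (cfc u A) = ∑ i, overlap hA hB i j * u (hA.eigenvalues i) := by
  change ((star (hB.eigenvectorUnitary : Matrix n n ℂ) * cfc u A * hB.eigenvectorUnitary) j j).re = _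
  rw [hA.cfc_eq, Matrix.IsHermitian.cfc, Unitary.conjStarAlgAut_apply]
  set U : Matrix n n ℂ := (hA.eigenvectorUnitary : Matrix n n ℂ) with hU
  set V : Matrix n n ℂ := (hB.eigenvectorUnitary : Matrix n n ℂ) with hV
  set D := Matrix.diagonal (RCLike.ofReal ∘ u ∘ hA.eigenvalues : n → ℂ)
  have h1 : star V * (U * D * star U) * V = star (star U * V) * (D * (star U * V)) := by
    simp only [Matrix.mul_assoc, star_mul, star_star]
  rw [h1, Matrix.mul_apply, Complex.re_sum]
  refine Finset.sum_congr rfl fun i _ => ?_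
  have h2 : star (star U * V) j i * (D * (star U * V)) i j =
      ((overlap hA hB i j * u (hA.eigenvalues i) : ℝ) : ℂ) := by
    rw [overlap, Matrix.diagonal_mul, Matrix.star_apply]
    push_cast
    rw [← Complex.mul_conj]
    change star ((star U * V) i j) * (((u (hA.eigenvalues i) : ℝ) : ℂ) * (star U * V) i j) =
      (star U * V) i j * star ((star U * V) i j) * _
    ring
  rw [h2, Complex.ofReal_re]

lemma eigenbasisDiag_self {B : Matrix n n ℂ} (hB : B.IsHermitian) (j : n) :
    eigenbasisDiag hB j B = hB.eigenvalues j := by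
  change ((star (hB.eigenvectorUnitary : Matrix n n ℂ) * B * hB.eigenvectorUnitary) j j).re = _
  have := hB.conjStarAlgAut_star_eigenvectorUnitary
  rw [Unitary.conjStarAlgAut_star_apply] at this
  rw [this, Matrix.diagonal_apply_eq]
  simp

lemma eigenbasisDiag_apply {A B : Matrix n n ℂ} (hB : B.IsHermitian) (hA : A.IsHermitian) (j : n) :
    eigenbasisDiag hB j A = ∑ i, overlap hA hB i j * hA.eigenvalues i := by
  rw [← eigenbasisDiag_cfc hB hA (fun x => x), hA.cfc_id_eq]

lemma sum_eigenbasisDiag_cfc {A B : Matrix n n ℂ} (hB : B.IsHermitian) (hA : A.IsHermitian)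
    (u : ℝ → ℝ) : ∑ j, eigenbasisDiag hB j (cfc u A) = (cfc u A).trace.re := by
  simp_rw [eigenbasisDiag_cfc hB hA]
  rw [Finset.sum_comm, sum_overlap_mul_left hA hB]

/-- Peierls' inequality for absolute powers. -/
lemma sum_abs_eigenbasisDiag_rpow_le {A B : Matrix n n ℂ} (hB : B.IsHermitian)
    (hA : A.IsHermitian) {q : ℝ} (hq : 1 ≤ q) :
    ∑ j, |eigenbasisDiag hB j A| ^ q ≤ tracePow q A := by
  rw [tracePow, ← sum_eigenbasisDiag_cfc hB hA]
  refine Finset.sum_le_sum fun j _ => ?_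
  rw [eigenbasisDiag_cfc hB hA, eigenbasisDiag_apply hB hA]
  refine le_trans (Real.rpow_le_rpow (abs_nonneg _) (Finset.abs_sum_le_sum_abs _ _)
    (by linarith)) ?_
  have : ∀ i, |overlap hA hB i j * hA.eigenvalues i| = overlap hA hB i j * |hA.eigenvalues i| :=
    fun i => by rw [abs_mul, abs_of_nonneg (overlap_nonneg _ _ _ _)]
  simp only [this]
  -- Jensen: each diagonal entry is an average of the eigenvalues of `A` with weights that sum to
  -- one.
  exact Real.rpow_arith_mean_le_arith_mean_rpow _ _ _ (fun i _ => overlap_nonneg _ _ _ _)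
    (sum_overlap_left hA hB j) (fun i _ => abs_nonneg _) hq

lemma isHermitian_sum {m ι : Type*} {I : Finset ι} {A : ι → Matrix m m ℂ}
    (hA : ∀ k ∈ I, (A k).IsHermitian) : (∑ k ∈ I, A k).IsHermitian := by
  rw [Matrix.IsHermitian, Matrix.conjTranspose_sum]
  exact Finset.sum_congr rfl hA

/-- The power mean inequality is applied to the diagonals in the eigenbasis of the sum, then
Peierls' inequality to each summand. The bound is crude and serves only integrability. -/
lemma tracePow_sum_le {ι : Type*} (I : Finset ι) {A : ι → Matrix n n ℂ}
    (hA : ∀ k, (A k).IsHermitian) {q : ℝ} (hq : 1 ≤ q) :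
    tracePow q (∑ k ∈ I, A k) ≤ (I.card : ℝ) ^ (q - 1) * ∑ k ∈ I, tracePow q (A k) := by
  have hB : (∑ k ∈ I, A k).IsHermitian := isHermitian_sum fun k _ => hA k
  have h1 : ∀ j, hB.eigenvalues j = ∑ k ∈ I, eigenbasisDiag hB j (A k) := fun j => by
    rw [← map_sum, eigenbasisDiag_self]
  rw [tracePow_eq hB]
  calc ∑ j, |hB.eigenvalues j| ^ q
      ≤ ∑ j, (I.card : ℝ) ^ (q - 1) * ∑ k ∈ I, |eigenbasisDiag hB j (A k)| ^ q := by
        refine Finset.sum_le_sum fun j _ => ?_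
        rw [h1 j]
        exact (Real.rpow_le_rpow (abs_nonneg _) (Finset.abs_sum_le_sum_abs _ _)
          (by linarith)).trans (Real.rpow_sum_le_const_mul_sum_rpow I _ hq)
    _ ≤ _ := by
        rw [← Finset.mul_sum, Finset.sum_comm]
        exact mul_le_mul_of_nonneg_left (Finset.sum_le_sum fun k _ =>
          sum_abs_eigenbasisDiag_rpow_le hB (hA k) hq) (by positivity)

lemma Matrix.IsHermitian.sq_eq_cfc {A : Matrix n n ℂ} (hA : A.IsHermitian) :
    A ^ 2 = cfc (fun x : ℝ => x ^ 2) A := (cfc_pow_id A 2 (ha := hA)).symm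

lemma tracePow_sq {A : Matrix n n ℂ} (hA : A.IsHermitian) (q : ℝ) :
    tracePow q (A ^ 2) = tracePow (2 * q) A := by
  have h : cfc (fun x : ℝ => |x| ^ q) (cfc (fun x : ℝ => x ^ 2) A) =
      cfc (fun x : ℝ => |x ^ 2| ^ q) A :=
    (cfc_comp' (fun x : ℝ => |x| ^ q) (fun x => x ^ 2) A
      ((A.finite_real_spectrum.image _).continuousOn _) (A.continuousOn_real_spectrum _) hA).symm
  rw [tracePow, hA.sq_eq_cfc, h, tracePow]
  congr 3
  funext x
  rw [← sq_abs, abs_of_nonneg (by positivity), Real.rpow_mul (abs_nonneg x), Real.rpow_two]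

/-- Interpolation between the first and higher moments for a sum of squares of positive
semidefinite matrices. -/
lemma tracePow_sum_sq_le {ι : Type*} (I : Finset ι) {P : ι → Matrix n n ℂ}
    (hP : ∀ k, (P k).PosSemidef) {p : ℝ} (hp : 1 ≤ p) :
    tracePow p (∑ k ∈ I, P k ^ 2) ≤
      (∑ k ∈ I, tracePow (2 * p) (P k)) ^ (p / (2 * p - 1)) *
        tracePow (2 * p) (∑ k ∈ I, P k) ^ ((p - 1) / (2 * p - 1)) := by
  have hH : ∀ k, (P k).IsHermitian := fun k => (hP k).1
  have hB : (∑ k ∈ I, P k ^ 2).IsHermitian := isHermitian_sum fun k _ => (hH k).pow 2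
  have hS : (∑ k ∈ I, P k).IsHermitian := isHermitian_sum fun k _ => hH k
  have h2p : 0 < 2 * p - 1 := by linarith
  -- Everything is read off in the eigenbasis of `∑ P_k²`: for each eigenvector, `t`, `σ` and the
  -- eigenvalue are the moments of order `2p`, `1` and `2` of one and the same nonnegative weight on
  -- the eigenvalues of all `P_k`.
  set t : n → ℝ := fun j => ∑ k ∈ I, eigenbasisDiag hB j (cfc (fun x : ℝ => |x| ^ (2 * p)) (P k))
    with ht
  set σ : n → ℝ := fun j => eigenbasisDiag hB j (∑ k ∈ I, P k) with hσ
  have hσ' : ∀ j, σ j = ∑ x ∈ I ×ˢ Finset.univ,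
      overlap (hH x.1) hB x.2 j * (hH x.1).eigenvalues x.2 := fun j => by
    rw [Finset.sum_product]
    simp only [hσ, map_sum, eigenbasisDiag_apply hB (hH _)]
  have ht' : ∀ j, t j = ∑ x ∈ I ×ˢ Finset.univ,
      overlap (hH x.1) hB x.2 j * |(hH x.1).eigenvalues x.2| ^ (2 * p) := fun j => by
    rw [Finset.sum_product]
    simp only [ht, eigenbasisDiag_cfc hB (hH _)]
  have hev : ∀ k i, 0 ≤ (hH k).eigenvalues i := fun k i => (hP k).eigenvalues_nonneg i
  have hσ0 : ∀ j, 0 ≤ σ j := fun j => by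
    rw [hσ' j]
    exact Finset.sum_nonneg fun x _ => mul_nonneg (overlap_nonneg _ _ _ _) (hev _ _)
  have ht0 : ∀ j, 0 ≤ t j := fun j => by
    rw [ht' j]
    exact Finset.sum_nonneg fun x _ => mul_nonneg (overlap_nonneg _ _ _ _) (by positivity)
  -- Interpolation of the second moment: `2 = 2p · 1/(2p-1) + 1 · (2p-2)/(2p-1)`, and the two
  -- exponents sum to one.
  have hq : ∀ j, hB.eigenvalues j ≤ t j ^ (1 / (2 * p - 1)) * σ j ^ ((2 * p - 2) / (2 * p - 1)) ∧
      0 ≤ hB.eigenvalues j := fun j => by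
    have h1 : hB.eigenvalues j = ∑ x ∈ I ×ˢ Finset.univ,
        overlap (hH x.1) hB x.2 j * (hH x.1).eigenvalues x.2 ^ 2 := by
      rw [Finset.sum_product, ← eigenbasisDiag_self hB j, map_sum]
      refine Finset.sum_congr rfl fun k _ => ?_
      rw [← eigenbasisDiag_cfc hB (hH k) (fun x => x ^ 2), (hH k).sq_eq_cfc]
    refine ⟨?_, h1 ▸ Finset.sum_nonneg fun x _ => mul_nonneg (overlap_nonneg _ _ _ _)
      (sq_nonneg _)⟩
    rw [h1, ht' j, hσ' j]
    refine le_trans (Finset.sum_le_sum fun x _ => ?_) (sum_rpow_mul_rpow_le _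
      (fun x _ => overlap_nonneg (hH x.1) hB x.2 j) (fun x _ => by positivity)
      (fun x _ => hev _ _) (by positivity) (div_nonneg (by linarith) h2p.le)
      (by field_simp; ring))
    refine mul_le_mul_of_nonneg_left (le_of_eq ?_) (overlap_nonneg _ _ _ _)
    rw [abs_of_nonneg (hev _ _), ← Real.rpow_mul (hev _ _),
      ← Real.rpow_add_of_nonneg (hev _ _) (by positivity) (div_nonneg (by linarith) h2p.le),
      ← Real.rpow_two]
    congr 1
    field_simp
    ring
  have e1 : 0 ≤ p / (2 * p - 1) := by positivity
  have e2 : 0 ≤ (p - 1) / (2 * p - 1) := div_nonneg (by linarith) h2p.le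
  rw [tracePow_eq hB]
  calc ∑ j, |hB.eigenvalues j| ^ p
      ≤ ∑ j, 1 * (t j ^ (p / (2 * p - 1)) * (|σ j| ^ (2 * p)) ^ ((p - 1) / (2 * p - 1))) := by
        refine Finset.sum_le_sum fun j _ => ?_
        rw [abs_of_nonneg (hq j).2, one_mul]
        refine (Real.rpow_le_rpow (hq j).2 (hq j).1 (by linarith)).trans (le_of_eq ?_)
        rw [Real.mul_rpow (Real.rpow_nonneg (ht0 j) _) (Real.rpow_nonneg (hσ0 j) _),
          ← Real.rpow_mul (ht0 j), ← Real.rpow_mul (hσ0 j), abs_of_nonneg (hσ0 j),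
          ← Real.rpow_mul (hσ0 j)]
        congr 2 <;> ring
    -- Hölder over the eigenvectors; these exponents also sum to one. Then `∑ t` is an exact trace,
    -- while Peierls bounds `∑ |σ| ^ (2p)`.
    _ ≤ (∑ j, 1 * t j) ^ (p / (2 * p - 1)) *
          (∑ j, 1 * |σ j| ^ (2 * p)) ^ ((p - 1) / (2 * p - 1)) :=
        sum_rpow_mul_rpow_le _ (fun _ _ => zero_le_one) (fun j _ => ht0 j)
          (fun j _ => by positivity) e1 e2
          (by rw [← add_div, div_eq_one_iff_eq h2p.ne']; ring)
    _ ≤ _ := by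
        have h3 : ∑ j, 1 * t j = ∑ k ∈ I, tracePow (2 * p) (P k) := by
          simp only [one_mul, ht]
          rw [Finset.sum_comm]
          exact Finset.sum_congr rfl fun k _ => sum_eigenbasisDiag_cfc hB (hH k) _
        rw [h3]
        refine mul_le_mul_of_nonneg_left (Real.rpow_le_rpow (by positivity) ?_ e2)
          (Real.rpow_nonneg (Finset.sum_nonneg fun k _ => tracePow_nonneg (hH k) _) _)
        simp only [one_mul]
        exact sum_abs_eigenbasisDiag_rpow_le hB hS (by linarith)

/-- Entries of a unitary matrix are at most one in modulus and `|x| ≤ 1 + |x| ^ q`; hence a finite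
trace moment makes all entries integrable. -/
lemma norm_entry_le_add_tracePow {A : Matrix n n ℂ} (hA : A.IsHermitian) {q : ℝ} (hq : 1 ≤ q)
    (i j : n) : ‖A i j‖ ≤ Fintype.card n + tracePow q A := by
  have hU := hA.eigenvectorUnitary.2
  have h : A i j = ∑ k, (hA.eigenvectorUnitary : Matrix n n ℂ) i k * (hA.eigenvalues k : ℂ) *
      star ((hA.eigenvectorUnitary : Matrix n n ℂ) j k) := by
    conv_lhs => rw [hA.spectral_theorem, Unitary.conjStarAlgAut_apply]
    rw [Matrix.mul_apply]
    refine Finset.sum_congr rfl fun k _ => ?_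
    rw [Matrix.mul_diagonal, Matrix.star_apply]
    rfl
  rw [h, tracePow_eq hA]
  have hc : (Fintype.card n : ℝ) = ∑ _k : n, (1 : ℝ) := by simp
  rw [hc, ← Finset.sum_add_distrib]
  refine (norm_sum_le _ _).trans (Finset.sum_le_sum fun k _ => ?_)
  rw [norm_mul, norm_mul, norm_star, Complex.norm_real, Real.norm_eq_abs]
  have b1 := entry_norm_bound_of_unitary hU i k
  have b2 := entry_norm_bound_of_unitary hU j k
  have b3 : |hA.eigenvalues k| ≤ 1 + |hA.eigenvalues k| ^ q := by
    rcases le_total (|hA.eigenvalues k|) 1 with h | h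
    · have : 0 ≤ |hA.eigenvalues k| ^ q := by positivity
      linarith
    · have := Real.rpow_le_rpow_of_exponent_le h hq
      rw [Real.rpow_one] at this
      linarith
  calc _ ≤ 1 * |hA.eigenvalues k| * 1 := by gcongr
    _ ≤ _ := by linarith

lemma cfcAbs_rpow_eq {A : Matrix n n ℂ} (hA : A.IsHermitian) (q : ℝ) :
    CFC.abs A ^ q = cfc (fun x : ℝ => |x| ^ q) A := by
  rw [CFC.rpow_eq_cfc_real (CFC.abs_nonneg A), CFC.abs_eq_cfc_norm A hA]
  exact (cfc_comp' (fun x : ℝ => x ^ q) (fun x => ‖x‖) A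
    ((A.finite_real_spectrum.image _).continuousOn _) (A.continuousOn_real_spectrum _) hA).symm

end Trace

/-! ### Measurability and integrability. -/

section Measurability

instance complexMatrixSecondCountable (d : ℕ) :
    SecondCountableTopology (Matrix (Fin d) (Fin d) ℂ) :=
  (inferInstance : SecondCountableTopology (Fin d → Fin d → ℂ))

variable {d : ℕ}

open scoped Matrix.Norms.L2Operator in
lemma continuousOn_matrix_cfc {f : ℝ → ℝ} (hf : Continuous f) :
    ContinuousOn (cfc f) {A : Matrix (Fin d) (Fin d) ℂ | A.IsHermitian} :=
  ContinuousOn.cfc_of_mem_nhdsSet (s := Set.univ) f Filter.univ_mem continuousOn_id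
    (fun _ h => h) hf.continuousOn

lemma measurableSet_isHermitian :
    MeasurableSet {A : Matrix (Fin d) (Fin d) ℂ | A.IsHermitian} :=
  (isClosed_eq continuous_id.matrix_conjTranspose continuous_id).measurableSet

/-- The functional calculus is continuous on the closed set of Hermitian matrices and takes the
default value zero elsewhere, so it is measurable on the whole space. -/
lemma measurable_matrix_cfc {f : ℝ → ℝ} (hf : Continuous f) :
    Measurable (cfc f : Matrix (Fin d) (Fin d) ℂ → Matrix (Fin d) (Fin d) ℂ) := by
  refine measurable_of_restrict_of_restrict_compl measurableSet_isHermitian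
    (continuousOn_iff_continuous_domRestrict.1 (continuousOn_matrix_cfc hf)).measurable ?_
  have : Set.domRestrict {A : Matrix (Fin d) (Fin d) ℂ | A.IsHermitian}ᶜ (cfc f) =
      fun _ => 0 := by
    funext A
    exact cfc_apply_of_not_predicate _ A.2
  rw [this]
  exact measurable_const

lemma measurable_trace_re : Measurable fun A : Matrix (Fin d) (Fin d) ℂ => A.trace.re :=
  (Complex.continuous_re.comp continuous_id.matrix_trace).measurable

lemma continuous_abs_rpow {q : ℝ} (hq : 0 ≤ q) : Continuous fun x : ℝ => |x| ^ q :=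
  continuous_abs.rpow_const fun _ => Or.inr hq

lemma measurable_tracePow {q : ℝ} (hq : 0 ≤ q) :
    Measurable (tracePow q : Matrix (Fin d) (Fin d) ℂ → ℝ) :=
  measurable_trace_re.comp (measurable_matrix_cfc (continuous_abs_rpow hq))

variable {Ω : Type*} [MeasurableSpace Ω] {μ : Measure Ω}

lemma integrable_tracePow_sum {ι : Type*} (I : Finset ι) {A : ι → Ω → Matrix (Fin d) (Fin d) ℂ}
    (hm : ∀ k, Measurable (A k)) (hA : ∀ k ω, (A k ω).IsHermitian) {q : ℝ} (hq : 1 ≤ q)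
    (hint : ∀ k, Integrable (fun ω => tracePow q (A k ω)) μ) :
    Integrable (fun ω => tracePow q (∑ k ∈ I, A k ω)) μ := by
  refine ((integrable_finsetSum I fun k _ => hint k).const_mul
    ((I.card : ℝ) ^ (q - 1))).mono' ?_ (Filter.Eventually.of_forall fun ω => ?_)
  · exact ((measurable_tracePow (by linarith)).comp
      (Finset.measurable_sum I fun k _ => hm k)).aestronglyMeasurable
  · rw [Real.norm_eq_abs, abs_of_nonneg (tracePow_nonneg (isHermitian_sum fun k _ => hA k ω) q)]
    exact tracePow_sum_le I (fun k => hA k ω) hq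

lemma integrable_entry [IsFiniteMeasure μ] {A : Ω → Matrix (Fin d) (Fin d) ℂ} (hm : Measurable A)
    (hA : ∀ ω, (A ω).IsHermitian) {q : ℝ} (hq : 1 ≤ q)
    (hint : Integrable (fun ω => tracePow q (A ω)) μ) (i j : Fin d) :
    Integrable (fun ω => A ω i j) μ := by
  refine ((integrable_const ((Fintype.card (Fin d) : ℕ) : ℝ)).add hint).mono' ?_
    (Filter.Eventually.of_forall fun ω => norm_entry_le_add_tracePow (hA ω) hq i j)
  exact ((measurable_pi_apply j).comp ((measurable_pi_apply i).comp hm)).aestronglyMeasurable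

/-! ### Hölder's inequality for expected traces. -/

section Holder
variable {A B : Ω → Matrix (Fin d) (Fin d) ℂ} {p : ℝ}

lemma trace_cfc_nonneg {A : Matrix (Fin d) (Fin d) ℂ} (hA : A.IsHermitian) {F : ℝ → ℝ}
    (hF : ∀ x, 0 ≤ F x) : 0 ≤ (cfc F A).trace.re := by
  rw [trace_cfc hA]; exact Finset.sum_nonneg fun i _ => hF _

lemma integrable_trace_cfc_mul_cfc (hmA : Measurable A) (hmB : Measurable B)
    (hA : ∀ ω, (A ω).IsHermitian) (hB : ∀ ω, (B ω).IsHermitian)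
    {u v F G : ℝ → ℝ} (hcu : Continuous u) (hcv : Continuous v)
    {s t : ℝ} (hs : 0 ≤ s) (ht : 0 ≤ t) (hst : s + t = 1)
    (hF : ∀ x, 0 ≤ F x) (hG : ∀ x, 0 ≤ G x)
    (hu : ∀ x, |u x| ≤ F x ^ s) (hv : ∀ x, |v x| ≤ G x ^ t)
    (hFi : Integrable (fun ω => (cfc F (A ω)).trace.re) μ)
    (hGi : Integrable (fun ω => (cfc G (B ω)).trace.re) μ) :
    Integrable (fun ω => (cfc u (A ω) * cfc v (B ω)).trace.re) μ := by
  refine (hFi.add hGi).mono' (measurable_trace_re.comp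
    (((measurable_matrix_cfc hcu).comp hmA).mul
      ((measurable_matrix_cfc hcv).comp hmB))).aestronglyMeasurable
    (Filter.Eventually.of_forall fun ω => ?_)
  exact (abs_trace_cfc_mul_cfc_le (hA ω) (hB ω) hs ht hst hF hG hu hv).trans
    (rpow_mul_rpow_le_add (trace_cfc_nonneg (hA ω) hF) (trace_cfc_nonneg (hB ω) hG) hs ht hst)

/-- Hölder is used twice with the same exponents: over pairs of eigenvalues, then over the
probability space. -/
lemma integral_trace_cfc_mul_cfc_le
    (hA : ∀ ω, (A ω).IsHermitian) (hB : ∀ ω, (B ω).IsHermitian)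
    {u v F G : ℝ → ℝ} {s t : ℝ} (hs : 0 ≤ s) (ht : 0 ≤ t) (hst : s + t = 1)
    (hF : ∀ x, 0 ≤ F x) (hG : ∀ x, 0 ≤ G x)
    (hu : ∀ x, |u x| ≤ F x ^ s) (hv : ∀ x, |v x| ≤ G x ^ t)
    (hFi : Integrable (fun ω => (cfc F (A ω)).trace.re) μ)
    (hGi : Integrable (fun ω => (cfc G (B ω)).trace.re) μ)
    (hi : Integrable (fun ω => (cfc u (A ω) * cfc v (B ω)).trace.re) μ) :
    ∫ ω, (cfc u (A ω) * cfc v (B ω)).trace.re ∂μ ≤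
      (∫ ω, (cfc F (A ω)).trace.re ∂μ) ^ s * (∫ ω, (cfc G (B ω)).trace.re ∂μ) ^ t := by
  have hF0 : ∀ ω, 0 ≤ (cfc F (A ω)).trace.re := fun ω => trace_cfc_nonneg (hA ω) hF
  have hG0 : ∀ ω, 0 ≤ (cfc G (B ω)).trace.re := fun ω => trace_cfc_nonneg (hB ω) hG
  refine (integral_mono hi ?_ fun ω => (le_abs_self _).trans
    (abs_trace_cfc_mul_cfc_le (hA ω) (hB ω) hs ht hst hF hG hu hv)).trans
    (integral_rpow_mul_rpow_le hFi hGi hF0 hG0 hs ht hst)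
  refine (hFi.add hGi).mono' ((hFi.aemeasurable.pow_const s).mul
    (hGi.aemeasurable.pow_const t)).aestronglyMeasurable (Filter.Eventually.of_forall fun ω => ?_)
  rw [Real.norm_eq_abs, abs_of_nonneg (mul_nonneg (Real.rpow_nonneg (hF0 ω) _)
    (Real.rpow_nonneg (hG0 ω) _))]
  exact rpow_mul_rpow_le_add (hF0 ω) (hG0 ω) hs ht hst

lemma abs_le_rpow_rpow_inv (hp : 1 ≤ p) (x : ℝ) : |x| ≤ (|x| ^ p) ^ (1 / p) := by
  rw [← Real.rpow_mul (abs_nonneg x), mul_one_div_cancel (by linarith), Real.rpow_one]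

lemma abs_signedPow_le (hp : 1 ≤ p) (x : ℝ) :
    |signedPow (2 * p - 1) x| ≤ (|x| ^ (2 * p)) ^ ((2 * p - 1) / (2 * p)) := by
  rw [← Real.rpow_mul (abs_nonneg x), mul_div_cancel₀ _ (by linarith),
    abs_signedPow (by linarith)]

lemma abs_abs_rpow_le (hp : 1 ≤ p) (x : ℝ) :
    |(|x| ^ (2 * p - 1 - 1))| ≤ (|x| ^ (2 * p)) ^ ((p - 1) / p) := by
  rw [← Real.rpow_mul (abs_nonneg x), abs_of_nonneg (by positivity)]
  refine le_of_eq (congrArg _ ?_)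
  field_simp
  ring

section
variable (hmA : Measurable A) (hmB : Measurable B)
    (hA : ∀ ω, (A ω).IsHermitian) (hB : ∀ ω, (B ω).IsHermitian)
    (hBi : Integrable (fun ω => tracePow (2 * p) (B ω)) μ) (hp : 1 ≤ p)

include hmA hmB hA hB hBi hp

lemma integrable_trace_mul_signedPow (hAi : Integrable (fun ω => tracePow (2 * p) (A ω)) μ) :
    Integrable (fun ω => (A ω * cfc (signedPow (2 * p - 1)) (B ω)).trace.re) μ := by
  have := integrable_trace_cfc_mul_cfc (μ := μ) hmA hmB hA hB (u := fun x => x)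
    (v := signedPow (2 * p - 1)) continuous_id (continuous_signedPow (by linarith))
    (s := 1 / (2 * p)) (t := (2 * p - 1) / (2 * p)) (by positivity)
    (div_nonneg (by linarith) (by linarith)) (by field_simp; ring)
    (fun x => by positivity) (fun x => by positivity)
    (abs_le_rpow_rpow_inv (by linarith)) (abs_signedPow_le hp) hAi hBi
  simpa only [(hA _).cfc_id_eq] using this

lemma integral_trace_mul_signedPow_le (hAi : Integrable (fun ω => tracePow (2 * p) (A ω)) μ) :
    ∫ ω, (A ω * cfc (signedPow (2 * p - 1)) (B ω)).trace.re ∂μ ≤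
      (∫ ω, tracePow (2 * p) (A ω) ∂μ) ^ (1 / (2 * p)) *
        (∫ ω, tracePow (2 * p) (B ω) ∂μ) ^ ((2 * p - 1) / (2 * p)) := by
  have hi := integrable_trace_mul_signedPow hmA hmB hA hB hBi hp hAi
  have := integral_trace_cfc_mul_cfc_le (μ := μ) hA hB (u := fun x => x)
    (v := signedPow (2 * p - 1))
    (s := 1 / (2 * p)) (t := (2 * p - 1) / (2 * p)) (by positivity)
    (div_nonneg (by linarith) (by linarith)) (by field_simp; ring)
    (fun x => by positivity) (fun x => by positivity)
    (abs_le_rpow_rpow_inv (by linarith)) (abs_signedPow_le hp) hAi hBi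
    (by simpa only [(hA _).cfc_id_eq] using hi)
  simp only [(hA _).cfc_id_eq] at this
  exact this

lemma integrable_trace_mul_rpow (hAi : Integrable (fun ω => tracePow p (A ω)) μ) :
    Integrable (fun ω => (A ω * cfc (fun x : ℝ => |x| ^ (2 * p - 1 - 1)) (B ω)).trace.re) μ := by
  have := integrable_trace_cfc_mul_cfc (μ := μ) hmA hmB hA hB (u := fun x => x)
    (v := fun x : ℝ => |x| ^ (2 * p - 1 - 1)) continuous_id (continuous_abs_rpow (by linarith))
    (s := 1 / p) (t := (p - 1) / p) (by positivity)
    (div_nonneg (by linarith) (by linarith)) (by field_simp; ring)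
    (fun x => by positivity) (fun x => by positivity)
    (abs_le_rpow_rpow_inv hp) (abs_abs_rpow_le hp) hAi hBi
  simpa only [(hA _).cfc_id_eq] using this

lemma integral_trace_mul_rpow_le (hAi : Integrable (fun ω => tracePow p (A ω)) μ) :
    ∫ ω, (A ω * cfc (fun x : ℝ => |x| ^ (2 * p - 1 - 1)) (B ω)).trace.re ∂μ ≤
      (∫ ω, tracePow p (A ω) ∂μ) ^ (1 / p) *
        (∫ ω, tracePow (2 * p) (B ω) ∂μ) ^ ((p - 1) / p) := by
  have hi := integrable_trace_mul_rpow hmA hmB hA hB hBi hp hAi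
  have := integral_trace_cfc_mul_cfc_le (μ := μ) hA hB (u := fun x => x)
    (v := fun x : ℝ => |x| ^ (2 * p - 1 - 1))
    (s := 1 / p) (t := (p - 1) / p) (by positivity)
    (div_nonneg (by linarith) (by linarith)) (by field_simp; ring)
    (fun x => by positivity) (fun x => by positivity)
    (abs_le_rpow_rpow_inv hp) (abs_abs_rpow_le hp) hAi hBi
    (by simpa only [(hA _).cfc_id_eq] using hi)
  simp only [(hA _).cfc_id_eq] at this
  exact this

end
end Holder

/-! ### Expectations of random matrices under the trace. -/

section Expectation

lemma integral_trace_mul {C : Ω → Matrix (Fin d) (Fin d) ℂ}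
    (hC : ∀ i j, Integrable (fun ω => C ω i j) μ) (D : Matrix (Fin d) (Fin d) ℂ) :
    ∫ ω, (C ω * D).trace.re ∂μ = (matrixExpectation μ C * D).trace.re := by
  have h1 : ∀ i, Integrable (fun ω => ∑ j, C ω i j * D j i) μ := fun i =>
    integrable_finsetSum _ fun j _ => (hC i j).mul_const _
  have h2 : Integrable (fun ω => (C ω * D).trace) μ := by
    simp only [Matrix.trace, Matrix.diag_apply, Matrix.mul_apply]
    exact integrable_finsetSum _ fun i _ => h1 i
  have h3 : ∫ ω, (C ω * D).trace ∂μ = (matrixExpectation μ C * D).trace := by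
    simp only [Matrix.trace, Matrix.diag_apply, Matrix.mul_apply]
    rw [integral_finsetSum _ fun i _ => h1 i]
    refine Finset.sum_congr rfl fun i _ => ?_
    rw [integral_finsetSum _ fun j _ => (hC i j).mul_const _]
    refine Finset.sum_congr rfl fun j _ => ?_
    rw [integral_mul_const]; rfl
  rw [← h3]
  exact integral_re h2

/-- The second coordinate of `Ω × Ω` carries the independent copy; by Fubini it is averaged first,
with the other factor fixed. -/
lemma integral_prod_trace_mul [IsProbabilityMeasure μ] {C D : Ω → Matrix (Fin d) (Fin d) ℂ}
    (hC : ∀ i j, Integrable (fun ω => C ω i j) μ)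
    (hi : Integrable (fun x : Ω × Ω => (C x.2 * D x.1).trace.re) (μ.prod μ)) :
    ∫ x, (C x.2 * D x.1).trace.re ∂(μ.prod μ) =
      ∫ ω, (matrixExpectation μ C * D ω).trace.re ∂μ := by
  rw [integral_prod _ hi]
  exact integral_congr_ae (Filter.Eventually.of_forall fun ω => integral_trace_mul hC (D ω))

lemma isHermitian_matrixExpectation {C : Ω → Matrix (Fin d) (Fin d) ℂ}
    (hC : ∀ ω, (C ω).IsHermitian) : (matrixExpectation μ C).IsHermitian := by
  ext i j
  change star (∫ ω, C ω j i ∂μ) = ∫ ω, C ω i j ∂μ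
  rw [show star (∫ ω, C ω j i ∂μ) = ∫ ω, star (C ω j i) ∂μ from integral_conj.symm]
  refine integral_congr_ae (Filter.Eventually.of_forall fun ω => ?_)
  exact (hC ω).apply i j

lemma posSemidef_matrixExpectation {C : Ω → Matrix (Fin d) (Fin d) ℂ}
    (hi : ∀ i j, Integrable (fun ω => C ω i j) μ) (hC : ∀ ω, (C ω).PosSemidef) :
    (matrixExpectation μ C).PosSemidef := by
  have hH := isHermitian_matrixExpectation (μ := μ) fun ω => (hC ω).1
  refine Matrix.PosSemidef.of_dotProduct_mulVec_nonneg hH fun x => ?_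
  -- The quadratic form is a trace against a rank-one matrix, so it commutes with the expectation by
  -- `integral_trace_mul`.
  have key : ∀ A : Matrix (Fin d) (Fin d) ℂ,
      (A * Matrix.vecMulVec x (star x)).trace = star x ⬝ᵥ A.mulVec x := fun A => by
    rw [Matrix.mul_vecMulVec, Matrix.trace_vecMulVec, dotProduct_comm]
  rw [← key, RCLike.nonneg_iff (K := ℂ)]
  refine ⟨?_, ?_⟩
  · change 0 ≤ (_ : ℂ).re
    rw [← integral_trace_mul hi]
    refine integral_nonneg fun ω => ?_
    simp only [Pi.zero_apply]
    rw [key]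
    exact (RCLike.nonneg_iff.1 ((hC ω).dotProduct_mulVec_nonneg x)).1
  · rw [key]
    exact hH.im_star_dotProduct_mulVec_self x

end Expectation
end Measurability

/-! ### Exchangeable pairs. -/

section Exchange
variable {d : ℕ} {Ω : Type*} [MeasurableSpace Ω] {μ : Measure Ω}

lemma tracePow_neg {A : Matrix (Fin d) (Fin d) ℂ} (hA : A.IsHermitian) (q : ℝ) :
    tracePow q (-A) = tracePow q A := by
  have h : cfc (fun x : ℝ => |-x| ^ q) A = cfc (fun x : ℝ => |x| ^ q) (-A) :=
    cfc_comp_neg (fun x : ℝ => |x| ^ q) A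
      ((A.finite_real_spectrum.image _).continuousOn _) hA
  rw [tracePow, ← h, tracePow]
  simp only [abs_neg]

lemma integrable_tracePow_add {A B : Ω → Matrix (Fin d) (Fin d) ℂ} (hmA : Measurable A)
    (hmB : Measurable B) (hA : ∀ ω, (A ω).IsHermitian) (hB : ∀ ω, (B ω).IsHermitian) {q : ℝ}
    (hq : 1 ≤ q) (hAi : Integrable (fun ω => tracePow q (A ω)) μ)
    (hBi : Integrable (fun ω => tracePow q (B ω)) μ) :
    Integrable (fun ω => tracePow q (A ω + B ω)) μ := by
  have := integrable_tracePow_sum (μ := μ) (Finset.univ : Finset Bool)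
    (A := fun b => if b then A else B)
    (fun b => by cases b <;> simpa) (fun b ω => by cases b <;> simp [hA, hB]) hq
    (fun b => by cases b <;> simpa)
  simpa using this

lemma integrable_tracePow_sub {A B : Ω → Matrix (Fin d) (Fin d) ℂ} (hmA : Measurable A)
    (hmB : Measurable B) (hA : ∀ ω, (A ω).IsHermitian) (hB : ∀ ω, (B ω).IsHermitian) {q : ℝ}
    (hq : 1 ≤ q) (hAi : Integrable (fun ω => tracePow q (A ω)) μ)
    (hBi : Integrable (fun ω => tracePow q (B ω)) μ) :
    Integrable (fun ω => tracePow q (A ω - B ω)) μ := by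
  simp only [sub_eq_add_neg]
  refine integrable_tracePow_add hmA (B := fun ω => -B ω) hmB.neg hA (fun ω => (hB ω).neg) hq hAi ?_
  simpa only [tracePow_neg (hB _)] using hBi

variable [IsProbabilityMeasure μ]

/-- Exchangeability of the pair: the joint law is a product `ν ⊗ ρ ⊗ ν`, which is invariant under
swapping the outer factors. -/
lemma map_exchange {E : Type*} [MeasurableSpace E] {X R : Ω → E} (hX : Measurable X)
    (hR : Measurable R) (h : IndepFun X R μ) :
    (μ.prod μ).map (fun x : Ω × Ω => ((X x.1, R x.1), X x.2)) =
      (μ.prod μ).map (fun x : Ω × Ω => ((X x.2, R x.1), X x.1)) := by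
  set ν := μ.map X
  set ρ := μ.map R
  have : IsProbabilityMeasure ν := Measure.isProbabilityMeasure_map hX.aemeasurable
  have : IsProbabilityMeasure ρ := Measure.isProbabilityMeasure_map hR.aemeasurable
  have h1 : (μ.prod μ).map (fun x : Ω × Ω => ((X x.1, R x.1), X x.2)) = (ν.prod ρ).prod ν := by
    rw [← (indepFun_iff_map_prod_eq_prod_map_map hX.aemeasurable hR.aemeasurable).1 h,
      Measure.map_prod_map _ _ (hX.prodMk hR) hX]
    rfl
  have h2 : MeasurePreserving (fun y : (E × E) × E => ((y.2, y.1.2), y.1.1))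
      ((ν.prod ρ).prod ν) ((ν.prod ρ).prod ν) := by
    have a1 := measurePreserving_prodAssoc ν ρ ν
    have a2 : MeasurePreserving Prod.swap (ν.prod (ρ.prod ν)) ((ρ.prod ν).prod ν) :=
      Measure.measurePreserving_swap
    have a3 : MeasurePreserving Prod.swap (ρ.prod ν) (ν.prod ρ) := Measure.measurePreserving_swap
    exact (a3.prod (MeasurePreserving.id ν)).comp (a2.comp a1)
  have hT : Measurable (fun x : Ω × Ω => ((X x.1, R x.1), X x.2)) := by fun_prop
  rw [h1, ← h2.map_eq, ← h1, Measure.map_map h2.measurable hT]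
  rfl

lemma integral_exchange {E : Type*} [MeasurableSpace E] {X R : Ω → E} (hX : Measurable X)
    (hR : Measurable R) (h : IndepFun X R μ) {Φ : (E × E) × E → ℝ} (hΦ : Measurable Φ) :
    (∫ x : Ω × Ω, Φ ((X x.1, R x.1), X x.2) ∂(μ.prod μ) =
      ∫ x : Ω × Ω, Φ ((X x.2, R x.1), X x.1) ∂(μ.prod μ)) ∧
    (Integrable (fun x : Ω × Ω => Φ ((X x.1, R x.1), X x.2)) (μ.prod μ) →
      Integrable (fun x : Ω × Ω => Φ ((X x.2, R x.1), X x.1)) (μ.prod μ)) := by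
  have hT : Measurable (fun x : Ω × Ω => ((X x.1, R x.1), X x.2)) := by fun_prop
  have hT' : Measurable (fun x : Ω × Ω => ((X x.2, R x.1), X x.1)) := by fun_prop
  constructor
  · rw [← integral_map hT.aemeasurable hΦ.aestronglyMeasurable, map_exchange hX hR h,
      integral_map hT'.aemeasurable hΦ.aestronglyMeasurable]
  · intro hi
    have := (integrable_map_measure hΦ.aestronglyMeasurable hT.aemeasurable).2 hi
    rw [map_exchange hX hR h] at this
    exact (integrable_map_measure hΦ.aestronglyMeasurable hT'.aemeasurable).1 this

lemma integrable_tracePow_prod_sub {X : Ω → Matrix (Fin d) (Fin d) ℂ} {q : ℝ} (hq : 1 ≤ q)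
    (hmX : Measurable X) (hX : ∀ ω, (X ω).IsHermitian)
    (hXi : Integrable (fun ω => tracePow q (X ω)) μ) :
    Integrable (fun x : Ω × Ω => tracePow q (X x.1 - X x.2)) (μ.prod μ) :=
  integrable_tracePow_sub (μ := μ.prod μ) (hmX.comp measurable_fst) (hmX.comp measurable_snd)
    (fun x => hX x.1) (fun x => hX x.2) hq (hXi.comp_fst μ) (hXi.comp_snd μ)

lemma integrable_prod_trace_sub_mul_signedPow {X S : Ω → Matrix (Fin d) (Fin d) ℂ} {p : ℝ}
    (hmX : Measurable X) (hmS : Measurable S)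
    (hX : ∀ ω, (X ω).IsHermitian) (hS : ∀ ω, (S ω).IsHermitian) (hp : 1 ≤ p)
    (hXi : Integrable (fun ω => tracePow (2 * p) (X ω)) μ)
    (hSi : Integrable (fun ω => tracePow (2 * p) (S ω)) μ) :
    Integrable (fun x : Ω × Ω => ((X x.1 - X x.2) *
      cfc (signedPow (2 * p - 1)) (S x.1)).trace.re) (μ.prod μ) := by
  have a1 : Measurable (fun x : Ω × Ω => X x.1 - X x.2) :=
    (hmX.comp measurable_fst).sub (hmX.comp measurable_snd)
  have a2 : Measurable (fun x : Ω × Ω => S x.1) := hmS.comp measurable_fst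
  have a3 : Integrable (fun x : Ω × Ω => tracePow (2 * p) (S x.1)) (μ.prod μ) := hSi.comp_fst μ
  exact integrable_trace_mul_signedPow (μ := μ.prod μ) a1 a2
    (fun x => (hX x.1).sub (hX x.2)) (fun x => hS x.1) a3 hp
    (integrable_tracePow_prod_sub (by linarith) hmX hX hXi)

lemma integrable_prod_trace_sub_sq_mul_rpow {X S : Ω → Matrix (Fin d) (Fin d) ℂ} {p : ℝ}
    (hmX : Measurable X) (hmS : Measurable S)
    (hX : ∀ ω, (X ω).IsHermitian) (hS : ∀ ω, (S ω).IsHermitian) (hp : 1 ≤ p)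
    (hXi : Integrable (fun ω => tracePow (2 * p) (X ω)) μ)
    (hSi : Integrable (fun ω => tracePow (2 * p) (S ω)) μ) :
    Integrable (fun x : Ω × Ω => ((X x.1 - X x.2) ^ 2 *
      cfc (fun x : ℝ => |x| ^ (2 * p - 1 - 1)) (S x.1)).trace.re) (μ.prod μ) := by
  have a1 : Measurable (fun x : Ω × Ω => (X x.1 - X x.2) ^ 2) :=
    ((hmX.comp measurable_fst).sub (hmX.comp measurable_snd)).pow_const 2
  have a2 : Measurable (fun x : Ω × Ω => S x.1) := hmS.comp measurable_fst
  have a3 : Integrable (fun x : Ω × Ω => tracePow (2 * p) (S x.1)) (μ.prod μ) := hSi.comp_fst μ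
  have a4 : Integrable (fun x : Ω × Ω => tracePow p ((X x.1 - X x.2) ^ 2)) (μ.prod μ) :=
    (integrable_tracePow_prod_sub (by linarith) hmX hX hXi).congr
      (Filter.Eventually.of_forall fun x => (tracePow_sq ((hX x.1).sub (hX x.2)) p).symm)
  exact integrable_trace_mul_rpow (μ := μ.prod μ) a1 a2
    (fun x => ((hX x.1).sub (hX x.2)).pow 2) (fun x => hS x.1) a3 hp a4

/-- The exchangeable pairs estimate for one summand `X` that is independent of the rest `R`. -/
lemma integral_trace_sub_mul_signedPow_le {X R : Ω → Matrix (Fin d) (Fin d) ℂ} {p : ℝ}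
    (hmX : Measurable X) (hmR : Measurable R)
    (hX : ∀ ω, (X ω).IsHermitian) (hR : ∀ ω, (R ω).IsHermitian) (hind : IndepFun X R μ)
    (hp : p = 1 ∨ 3 / 2 ≤ p)
    (hXi : Integrable (fun ω => tracePow (2 * p) (X ω)) μ)
    (hSi : Integrable (fun ω => tracePow (2 * p) (X ω + R ω)) μ) :
    ∫ x : Ω × Ω, ((X x.1 - X x.2) *
        cfc (signedPow (2 * p - 1)) (X x.1 + R x.1)).trace.re ∂(μ.prod μ) ≤
      (2 * p - 1) / 2 * ∫ x : Ω × Ω, ((X x.1 - X x.2) ^ 2 *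
        cfc (fun x : ℝ => |x| ^ (2 * p - 1 - 1)) (X x.1 + R x.1)).trace.re ∂(μ.prod μ) := by
  have hp1 : 1 ≤ p := by rcases hp with h | h <;> linarith
  have hs : 2 * p - 1 = 1 ∨ 2 ≤ 2 * p - 1 := by
    rcases hp with h | h
    · left; linarith
    · right; linarith
  have hmc1 : Measurable (cfc (signedPow (2 * p - 1)) :
      Matrix (Fin d) (Fin d) ℂ → Matrix (Fin d) (Fin d) ℂ) :=
    measurable_matrix_cfc (continuous_signedPow (by linarith))
  have hmc2 : Measurable (cfc (fun x : ℝ => |x| ^ (2 * p - 1 - 1)) :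
      Matrix (Fin d) (Fin d) ℂ → Matrix (Fin d) (Fin d) ℂ) :=
    measurable_matrix_cfc (continuous_abs_rpow (by linarith))
  let M := Matrix (Fin d) (Fin d) ℂ
  let Φ₁ : (M × M) × M → ℝ := fun y =>
    ((y.1.1 - y.2) * cfc (signedPow (2 * p - 1)) (y.1.1 + y.1.2)).trace.re
  let Φ₂ : (M × M) × M → ℝ := fun y =>
    ((y.1.1 - y.2) ^ 2 * cfc (fun x : ℝ => |x| ^ (2 * p - 1 - 1)) (y.1.1 + y.1.2)).trace.re
  have hΦ₁ : Measurable Φ₁ := measurable_trace_re.comp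
    (((measurable_fst.comp measurable_fst).sub measurable_snd).mul
      (hmc1.comp ((measurable_fst.comp measurable_fst).add (measurable_snd.comp measurable_fst))))
  have hΦ₂ : Measurable Φ₂ := measurable_trace_re.comp
    ((((measurable_fst.comp measurable_fst).sub measurable_snd).pow_const 2).mul
      (hmc2.comp ((measurable_fst.comp measurable_fst).add (measurable_snd.comp measurable_fst))))
  have hS : ∀ ω, (X ω + R ω).IsHermitian := fun ω => (hX ω).add (hR ω)
  have hmS : Measurable fun ω => X ω + R ω := hmX.add hmR
  have i1 : Integrable (fun x : Ω × Ω => Φ₁ ((X x.1, R x.1), X x.2)) (μ.prod μ) :=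
    integrable_prod_trace_sub_mul_signedPow (S := fun ω => X ω + R ω) hmX hmS hX hS hp1 hXi hSi
  have i2 : Integrable (fun x : Ω × Ω => Φ₂ ((X x.1, R x.1), X x.2)) (μ.prod μ) :=
    integrable_prod_trace_sub_sq_mul_rpow (S := fun ω => X ω + R ω) hmX hmS hX hS hp1 hXi hSi
  obtain ⟨e1, j1⟩ := integral_exchange hmX hmR hind hΦ₁
  obtain ⟨e2, j2⟩ := integral_exchange hmX hmR hind hΦ₂
  -- Both integrands are symmetrized. The two copies of `Φ₁` combine to the trace of `(X - X')(g(S)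
  -- - g(S'))`, because `X - X' = S - S'`, and the mean value trace inequality applies pointwise.
  have key : ∫ x : Ω × Ω, (Φ₁ ((X x.1, R x.1), X x.2) + Φ₁ ((X x.2, R x.1), X x.1)) ∂(μ.prod μ) ≤
      ∫ x : Ω × Ω, (2 * p - 1) / 2 *
        (Φ₂ ((X x.1, R x.1), X x.2) + Φ₂ ((X x.2, R x.1), X x.1)) ∂(μ.prod μ) := by
    refine integral_mono (i1.add (j1 i1)) ((i2.add (j2 i2)).const_mul _) fun x => ?_
    have h := trace_sub_mul_signedPow_sub_le ((hX x.1).add (hR x.1)) ((hX x.2).add (hR x.1)) hs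
    rw [add_sub_add_right_eq_sub] at h
    have hsq : (X x.2 - X x.1) ^ 2 = (X x.1 - X x.2) ^ 2 := by noncomm_ring
    simp only [Φ₁, Φ₂, hsq]
    refine le_trans (le_of_eq ?_) h
    rw [← Complex.add_re, ← Matrix.trace_add]
    congr 2
    rw [Matrix.mul_sub, ← neg_sub (X x.1) (X x.2), Matrix.neg_mul, ← sub_eq_add_neg]
  rw [integral_const_mul, integral_add i1 (j1 i1), integral_add i2 (j2 i2), ← e1, ← e2] at key
  change ∫ x : Ω × Ω, Φ₁ ((X x.1, R x.1), X x.2) ∂(μ.prod μ) ≤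
    (2 * p - 1) / 2 * ∫ x : Ω × Ω, Φ₂ ((X x.1, R x.1), X x.2) ∂(μ.prod μ)
  linarith

lemma integral_prod_fst (f : Ω → ℝ) : ∫ x : Ω × Ω, f x.1 ∂(μ.prod μ) = ∫ ω, f ω ∂μ := by
  rw [integral_fun_fst f]
  simp

variable {ι : Type*} [Fintype ι] {Z : ι → Ω → Matrix (Fin d) (Fin d) ℂ} {p : ℝ}

/-- The exchangeable pairs estimate for the moments of a sum of independent random Hermitian
matrices. -/
lemma integral_tracePow_sum_le (hm : ∀ k, Measurable (Z k)) (hZ : ∀ k ω, (Z k ω).IsHermitian)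
    (hind : iIndepFun Z μ) (hp : p = 1 ∨ 3 / 2 ≤ p)
    (hi : ∀ k, Integrable (fun ω => tracePow (2 * p) (Z k ω)) μ) :
    ∫ ω, tracePow (2 * p) (∑ k, Z k ω) ∂μ ≤
      ∫ ω, ((∑ k, matrixExpectation μ (Z k)) *
        cfc (signedPow (2 * p - 1)) (∑ k, Z k ω)).trace.re ∂μ +
      (2 * p - 1) / 2 * ∑ k, ∫ x : Ω × Ω, ((Z k x.1 - Z k x.2) ^ 2 *
        cfc (fun x : ℝ => |x| ^ (2 * p - 1 - 1)) (∑ k, Z k x.1)).trace.re ∂(μ.prod μ) := by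
  classical
  have hp1 : 1 ≤ p := by rcases hp with h | h <;> linarith
  set S : Ω → Matrix (Fin d) (Fin d) ℂ := fun ω => ∑ k, Z k ω with hSdef
  have hmS : Measurable S := Finset.measurable_sum _ fun k _ => hm k
  have hS : ∀ ω, (S ω).IsHermitian := fun ω => isHermitian_sum fun k _ => hZ k ω
  have hSi : Integrable (fun ω => tracePow (2 * p) (S ω)) μ :=
    integrable_tracePow_sum _ hm hZ (by linarith) hi
  have iZ : ∀ k, Integrable (fun ω => (Z k ω * cfc (signedPow (2 * p - 1)) (S ω)).trace.re) μ :=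
    fun k => integrable_trace_mul_signedPow (hm k) hmS (hZ k) hS hSi hp1 (hi k)
  have iZ2 : ∀ k, Integrable (fun x : Ω × Ω =>
      (Z k x.2 * cfc (signedPow (2 * p - 1)) (S x.1)).trace.re) (μ.prod μ) :=
    fun k => by
      have a1 : Measurable (fun x : Ω × Ω => Z k x.2) := (hm k).comp measurable_snd
      have a2 : Measurable (fun x : Ω × Ω => S x.1) := hmS.comp measurable_fst
      have a3 : Integrable (fun x : Ω × Ω => tracePow (2 * p) (S x.1)) (μ.prod μ) :=
        hSi.comp_fst μ
      have a4 : Integrable (fun x : Ω × Ω => tracePow (2 * p) (Z k x.2)) (μ.prod μ) :=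
        (hi k).comp_snd μ
      exact integrable_trace_mul_signedPow (μ := μ.prod μ) a1 a2 (fun x => hZ k x.2)
        (fun x => hS x.1) a3 hp1 a4
  have hent : ∀ k i j, Integrable (fun ω => Z k ω i j) μ := fun k =>
    integrable_entry (hm k) (hZ k) (by linarith) (hi k)
  -- This integrand is a marginal of the integrand in `iZ2`, hence integrable by Fubini.
  have iM : ∀ k, Integrable (fun ω => (matrixExpectation μ (Z k) *
      cfc (signedPow (2 * p - 1)) (S ω)).trace.re) μ := fun k => by
    have e : ∀ ω, ∫ ω', (Z k ω' * cfc (signedPow (2 * p - 1)) (S ω)).trace.re ∂μ =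
        (matrixExpectation μ (Z k) * cfc (signedPow (2 * p - 1)) (S ω)).trace.re :=
      fun ω => integral_trace_mul (hent k) _
    have h := (iZ2 k).integral_prod_left
    simp only [e] at h
    exact h
  have h0 : ∀ ω, tracePow (2 * p) (S ω) =
      ∑ k, (Z k ω * cfc (signedPow (2 * p - 1)) (S ω)).trace.re := fun ω => by
    rw [← Complex.re_sum, ← Matrix.trace_sum, ← Finset.sum_mul]
    have : S ω * cfc (signedPow (2 * p - 1)) (S ω) =
        cfc (fun x => x * signedPow (2 * p - 1) x) (S ω) := by
      rw [← Matrix.cfc_mul_cfc (fun x => x), (hS ω).cfc_id_eq]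
    change _ = (S ω * cfc (signedPow (2 * p - 1)) (S ω)).trace.re
    rw [this, tracePow]
    simp only [mul_signedPow (by linarith : 0 < 2 * p - 1), sub_add_cancel]
  have hk : ∀ k, ∫ ω, (Z k ω * cfc (signedPow (2 * p - 1)) (S ω)).trace.re ∂μ ≤
      ∫ ω, (matrixExpectation μ (Z k) * cfc (signedPow (2 * p - 1)) (S ω)).trace.re ∂μ +
      (2 * p - 1) / 2 * ∫ x : Ω × Ω, ((Z k x.1 - Z k x.2) ^ 2 *
        cfc (fun x : ℝ => |x| ^ (2 * p - 1 - 1)) (S x.1)).trace.re ∂(μ.prod μ) := fun k => by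
    set R : Ω → Matrix (Fin d) (Fin d) ℂ := ∑ j ∈ Finset.univ.erase k, Z j with hR
    have hSR : S = fun ω => Z k ω + R ω := by
      funext ω
      rw [hR, Finset.sum_apply, hSdef]
      exact (Finset.add_sum_erase _ (fun j => Z j ω) (Finset.mem_univ k)).symm
    have hmR : Measurable R := by
      have : R = fun ω => ∑ j ∈ Finset.univ.erase k, Z j ω := by
        funext ω; rw [hR, Finset.sum_apply]
      rw [this]
      exact Finset.measurable_sum _ fun j _ => hm j
    have hRH : ∀ ω, (R ω).IsHermitian := fun ω => by
      rw [hR, Finset.sum_apply]; exact isHermitian_sum fun j _ => hZ j ω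
    have hindk : IndepFun (Z k) R μ :=
      (hind.indepFun_finsetSum_of_notMem hm (Finset.notMem_erase k _)).symm
    have h := integral_trace_sub_mul_signedPow_le (hm k) hmR (hZ k) hRH hindk hp (hi k)
      (by rw [hSR] at hSi; exact hSi)
    have hSR' : ∀ ω, Z k ω + R ω = S ω := fun ω => by rw [hSR]
    simp only [hSR'] at h
    -- The term with the independent copy averages to the drift, the trace of `E Z_k` against the
    -- signed power of `S`.
    have h' : ∫ x : Ω × Ω, ((Z k x.1 - Z k x.2) *
        cfc (signedPow (2 * p - 1)) (S x.1)).trace.re ∂(μ.prod μ) =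
        ∫ ω, (Z k ω * cfc (signedPow (2 * p - 1)) (S ω)).trace.re ∂μ -
        ∫ ω, (matrixExpectation μ (Z k) * cfc (signedPow (2 * p - 1)) (S ω)).trace.re ∂μ := by
      have e1 := integral_prod_trace_mul (C := Z k)
        (D := fun ω => cfc (signedPow (2 * p - 1)) (S ω)) (hent k) (iZ2 k)
      have e2 := integral_prod_fst (μ := μ)
        fun ω => (Z k ω * cfc (signedPow (2 * p - 1)) (S ω)).trace.re
      have e3 : Integrable (fun x : Ω × Ω =>
        (Z k x.1 * cfc (signedPow (2 * p - 1)) (S x.1)).trace.re) (μ.prod μ) := (iZ k).comp_fst μ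
      rw [← e1, ← e2, ← integral_sub e3 (iZ2 k)]
      simp only [Matrix.sub_mul, Matrix.trace_sub, Complex.sub_re]
    linarith
  change ∫ ω, tracePow (2 * p) (S ω) ∂μ ≤ ∫ ω, ((∑ k, matrixExpectation μ (Z k)) *
      cfc (signedPow (2 * p - 1)) (S ω)).trace.re ∂μ + (2 * p - 1) / 2 * ∑ k,
      ∫ x : Ω × Ω, ((Z k x.1 - Z k x.2) ^ 2 *
        cfc (fun x : ℝ => |x| ^ (2 * p - 1 - 1)) (S x.1)).trace.re ∂(μ.prod μ)
  simp only [h0, Finset.sum_mul, Matrix.trace_sum, Complex.re_sum]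
  rw [integral_finsetSum _ fun k _ => iZ k, integral_finsetSum _ fun k _ => iM k, Finset.mul_sum,
    ← Finset.sum_add_distrib]
  exact Finset.sum_le_sum fun k _ => hk k

end Exchange

/-! ### Moment bounds for the two kinds of sums. -/

section Moments
variable {d : ℕ} {Ω : Type*} [MeasurableSpace Ω] {μ : Measure Ω} [IsProbabilityMeasure μ]
  {ι : Type*} [Fintype ι] {p : ℝ}

lemma integral_prod_snd (f : Ω → ℝ) : ∫ x : Ω × Ω, f x.2 ∂(μ.prod μ) = ∫ ω, f ω ∂μ := by
  rw [integral_fun_snd f]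
  simp

/-- If `X ≤ Θ` the claim is immediate, since `4p - 2 ≥ 1`. Otherwise weight can be moved from `Θ` to
the larger `X` until both exponents are `1/2`, after which `X ^ ((2p - 1) / (2p))` cancels. -/
lemma rpow_le_of_interpolated_self_bound {X Θ m p : ℝ} (hp : 1 ≤ p) (hX : 0 ≤ X) (hm : 0 ≤ m)
    (hΘ : 0 ≤ Θ)
    (h : X ≤ m * X ^ ((2 * p - 1) / (2 * p)) +
      (4 * p - 2) * (Θ ^ (p / (2 * p - 1)) * X ^ ((p - 1) / (2 * p - 1))) ^ (1 / p) *
        X ^ ((p - 1) / p)) :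
    X ^ (1 / (2 * p)) ≤ m + (4 * p - 2) * Θ ^ (1 / (2 * p)) := by
  have h2p : 0 < 2 * p - 1 := by linarith
  have hp0 : 0 < p := by linarith
  have hθ := Real.rpow_nonneg hΘ (1 / (2 * p))
  rcases le_or_gt X Θ with hle | hlt
  · have := Real.rpow_le_rpow hX hle (by positivity : 0 ≤ 1 / (2 * p))
    nlinarith
  have hX0 : 0 < X := hΘ.trans_lt hlt
  have hW : 0 < X ^ ((2 * p - 1) / (2 * p)) := Real.rpow_pos_of_pos hX0 _
  have h1 : Θ ^ (p / (2 * p - 1)) * X ^ ((p - 1) / (2 * p - 1)) ≤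
      Θ ^ (1 / 2 : ℝ) * X ^ (1 / 2 : ℝ) := by
    have e1 : Θ ^ (p / (2 * p - 1)) = Θ ^ (1 / 2 : ℝ) * Θ ^ (1 / (2 * (2 * p - 1))) := by
      rw [← Real.rpow_add_of_nonneg hΘ (by norm_num) (by positivity)]
      congr 1
      rw [div_add_div _ _ two_ne_zero (by positivity), div_eq_div_iff h2p.ne' (by positivity)]
      ring
    have e2 : X ^ (1 / 2 : ℝ) = X ^ (1 / (2 * (2 * p - 1))) * X ^ ((p - 1) / (2 * p - 1)) := by
      rw [← Real.rpow_add hX0]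
      congr 1
      field_simp
      ring
    rw [e1, e2, mul_assoc]
    gcongr
  have h2 : (Θ ^ (p / (2 * p - 1)) * X ^ ((p - 1) / (2 * p - 1))) ^ (1 / p) *
      X ^ ((p - 1) / p) ≤ Θ ^ (1 / (2 * p)) * X ^ ((2 * p - 1) / (2 * p)) := by
    calc _ ≤ (Θ ^ (1 / 2 : ℝ) * X ^ (1 / 2 : ℝ)) ^ (1 / p) * X ^ ((p - 1) / p) := by gcongr
      _ = Θ ^ (1 / (2 * p)) * X ^ ((2 * p - 1) / (2 * p)) := by
        rw [Real.mul_rpow (by positivity) (by positivity), ← Real.rpow_mul hΘ, ← Real.rpow_mul hX,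
          mul_assoc, ← Real.rpow_add hX0]
        congr 2
        · field_simp
        · field_simp
          ring
  have h3 : X = X ^ (1 / (2 * p)) * X ^ ((2 * p - 1) / (2 * p)) := by
    rw [← Real.rpow_add hX0, ← add_div, add_sub_cancel, div_self (by linarith), Real.rpow_one]
  have h4 : X ^ (1 / (2 * p)) * X ^ ((2 * p - 1) / (2 * p)) ≤
      (m + (4 * p - 2) * Θ ^ (1 / (2 * p))) * X ^ ((2 * p - 1) / (2 * p)) := by
    rw [← h3]
    nlinarith [mul_le_mul_of_nonneg_left h2 (by linarith : 0 ≤ 4 * p - 2)]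
  exact le_of_mul_le_mul_right h4 hW

lemma rpow_le_of_self_bound {X T c p : ℝ} (hp : 1 ≤ p) (hX : 0 ≤ X) (hc : 0 ≤ c) (hT : 0 ≤ T)
    (h : X ≤ (4 * p - 1) / 2 * ((c + (4 * p - 2) * T ^ (1 / (2 * p))) *
      X ^ ((2 * p - 1) / (2 * p)) + c * X ^ ((2 * p - 1) / (2 * p)))) :
    X ^ (1 / (4 * p)) ≤ √(4 * p - 1) * √c + (4 * p - 1) * T ^ (1 / (4 * p)) := by
  have hτ := Real.rpow_nonneg hT (1 / (4 * p))
  have hr : 0 ≤ √(4 * p - 1) * √c + (4 * p - 1) * T ^ (1 / (4 * p)) :=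
    add_nonneg (by positivity) (mul_nonneg (by linarith) hτ)
  rcases hX.eq_or_lt with h0 | hX0
  · rwa [← h0, Real.zero_rpow (by positivity)]
  have hW : 0 < X ^ ((2 * p - 1) / (2 * p)) := Real.rpow_pos_of_pos hX0 _
  have h3 : X = X ^ (1 / (2 * p)) * X ^ ((2 * p - 1) / (2 * p)) := by
    rw [← Real.rpow_add hX0, ← add_div, add_sub_cancel, div_self (by linarith), Real.rpow_one]
  have h4 : X ^ (1 / (2 * p)) * X ^ ((2 * p - 1) / (2 * p)) ≤
      ((4 * p - 1) * (c + (2 * p - 1) * T ^ (1 / (2 * p)))) * X ^ ((2 * p - 1) / (2 * p)) := by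
    rw [← h3]
    exact h.trans (le_of_eq (by ring))
  have h5 := le_of_mul_le_mul_right h4 hW
  have sq_eq : ∀ {x : ℝ}, 0 ≤ x → x ^ (1 / (2 * p)) = (x ^ (1 / (4 * p))) ^ 2 := fun {x} hx => by
    rw [← Real.rpow_natCast, ← Real.rpow_mul hx]
    congr 1
    push_cast
    field_simp
    norm_num
  rw [sq_eq hX, sq_eq hT] at h5
  refine (sq_le_sq₀ (Real.rpow_nonneg hX _) hr).1 (h5.trans ?_)
  have s1 := Real.sq_sqrt (by linarith : 0 ≤ 4 * p - 1)
  have s2 := Real.sq_sqrt hc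
  have e : (√(4 * p - 1) * √c + (4 * p - 1) * T ^ (1 / (4 * p))) ^ 2 =
      (4 * p - 1) * c + 2 * (√(4 * p - 1) * √c * ((4 * p - 1) * T ^ (1 / (4 * p)))) +
        (4 * p - 1) ^ 2 * (T ^ (1 / (4 * p))) ^ 2 := by
    rw [add_sq, mul_pow, s1, s2]; ring
  rw [e]
  have n1 : 0 ≤ √(4 * p - 1) * √c * ((4 * p - 1) * T ^ (1 / (4 * p))) :=
    mul_nonneg (by positivity) (mul_nonneg (by linarith) hτ)
  -- The slack left by squaring, `(4p - 1)² - (4p - 1)(2p - 1) = (4p - 1) · 2p`; the cross term in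
  -- `n1` is dropped as well.
  have n2 : 0 ≤ (4 * p - 1) * (2 * p) * (T ^ (1 / (4 * p))) ^ 2 :=
    mul_nonneg (mul_nonneg (by linarith) (by linarith)) (sq_nonneg _)
  nlinarith

lemma integral_trace_const_mul_signedPow_le {S : Ω → Matrix (Fin d) (Fin d) ℂ}
    {M : Matrix (Fin d) (Fin d) ℂ} (hM : M.IsHermitian) (hmS : Measurable S)
    (hS : ∀ ω, (S ω).IsHermitian) (hp : 1 ≤ p)
    (hSi : Integrable (fun ω => tracePow (2 * p) (S ω)) μ) :
    ∫ ω, (M * cfc (signedPow (2 * p - 1)) (S ω)).trace.re ∂μ ≤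
      tracePow (2 * p) M ^ (1 / (2 * p)) *
        (∫ ω, tracePow (2 * p) (S ω) ∂μ) ^ ((2 * p - 1) / (2 * p)) := by
  have := integral_trace_mul_signedPow_le (A := fun _ : Ω => M) measurable_const hmS
    (fun _ => hM) hS hSi hp (integrable_const _)
  simpa using this

lemma integral_trace_const_mul_rpow_le {S : Ω → Matrix (Fin d) (Fin d) ℂ}
    {M : Matrix (Fin d) (Fin d) ℂ} (hM : M.IsHermitian) (hmS : Measurable S)
    (hS : ∀ ω, (S ω).IsHermitian) (hp : 1 ≤ p)
    (hSi : Integrable (fun ω => tracePow (2 * p) (S ω)) μ) :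
    ∫ ω, (M * cfc (fun x : ℝ => |x| ^ (2 * p - 1 - 1)) (S ω)).trace.re ∂μ ≤
      tracePow p M ^ (1 / p) * (∫ ω, tracePow (2 * p) (S ω) ∂μ) ^ ((p - 1) / p) := by
  have := integral_trace_mul_rpow_le (A := fun _ : Ω => M) measurable_const hmS
    (fun _ => hM) hS hSi hp (integrable_const _)
  simpa using this

section Independent
variable {S Q : Ω → Matrix (Fin d) (Fin d) ℂ}

lemma integrable_prod_trace_mul_rpow (hmQ : Measurable Q) (hmS : Measurable S)
    (hQ : ∀ ω, (Q ω).IsHermitian) (hS : ∀ ω, (S ω).IsHermitian) (hp : 1 ≤ p)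
    (hQi : Integrable (fun ω => tracePow p (Q ω)) μ)
    (hSi : Integrable (fun ω => tracePow (2 * p) (S ω)) μ) :
    Integrable (fun x : Ω × Ω => (Q x.2 * cfc (fun x : ℝ => |x| ^ (2 * p - 1 - 1))
      (S x.1)).trace.re) (μ.prod μ) := by
  have a1 : Measurable (fun x : Ω × Ω => Q x.2) := hmQ.comp measurable_snd
  have a2 : Measurable (fun x : Ω × Ω => S x.1) := hmS.comp measurable_fst
  have a3 : Integrable (fun x : Ω × Ω => tracePow (2 * p) (S x.1)) (μ.prod μ) := hSi.comp_fst μ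
  have a4 : Integrable (fun x : Ω × Ω => tracePow p (Q x.2)) (μ.prod μ) := hQi.comp_snd μ
  exact integrable_trace_mul_rpow (μ := μ.prod μ) a1 a2 (fun x => hQ x.2) (fun x => hS x.1) a3 hp a4

lemma integral_prod_trace_mul_rpow_le (hmQ : Measurable Q) (hmS : Measurable S)
    (hQ : ∀ ω, (Q ω).IsHermitian) (hS : ∀ ω, (S ω).IsHermitian) (hp : 1 ≤ p)
    (hQi : Integrable (fun ω => tracePow p (Q ω)) μ)
    (hSi : Integrable (fun ω => tracePow (2 * p) (S ω)) μ) :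
    ∫ x : Ω × Ω, (Q x.2 * cfc (fun x : ℝ => |x| ^ (2 * p - 1 - 1))
      (S x.1)).trace.re ∂(μ.prod μ) ≤
      (∫ ω, tracePow p (Q ω) ∂μ) ^ (1 / p) *
        (∫ ω, tracePow (2 * p) (S ω) ∂μ) ^ ((p - 1) / p) := by
  have a1 : Measurable (fun x : Ω × Ω => Q x.2) := hmQ.comp measurable_snd
  have a2 : Measurable (fun x : Ω × Ω => S x.1) := hmS.comp measurable_fst
  have a3 : Integrable (fun x : Ω × Ω => tracePow (2 * p) (S x.1)) (μ.prod μ) := hSi.comp_fst μ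
  have a4 : Integrable (fun x : Ω × Ω => tracePow p (Q x.2)) (μ.prod μ) := hQi.comp_snd μ
  have := integral_trace_mul_rpow_le (μ := μ.prod μ) a1 a2 (fun x => hQ x.2) (fun x => hS x.1)
    a3 hp a4
  rwa [integral_prod_fst fun ω => tracePow (2 * p) (S ω),
    integral_prod_snd fun ω => tracePow p (Q ω)] at this

end Independent

lemma integrable_tracePow_sq {Ω : Type*} [MeasurableSpace Ω] {μ : Measure Ω}
    {Y : Ω → Matrix (Fin d) (Fin d) ℂ} (hY : ∀ ω, (Y ω).IsHermitian)
    (hi : Integrable (fun ω => tracePow (2 * p) (Y ω)) μ) :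
    Integrable (fun ω => tracePow p (Y ω ^ 2)) μ :=
  hi.congr (Filter.Eventually.of_forall fun ω => (tracePow_sq (hY ω) p).symm)

/-- The pointwise interpolation has exponents that sum to one, so Hölder carries it over to
expectations unchanged. -/
lemma integral_tracePow_sum_sq_le {Ω : Type*} [MeasurableSpace Ω] {μ : Measure Ω}
    {P : ι → Ω → Matrix (Fin d) (Fin d) ℂ}
    (hm : ∀ k, Measurable (P k)) (hP : ∀ k ω, (P k ω).PosSemidef) (hp : 1 ≤ p)
    (hi : ∀ k, Integrable (fun ω => tracePow (2 * p) (P k ω)) μ) :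
    ∫ ω, tracePow p (∑ k, P k ω ^ 2) ∂μ ≤
      (∑ k, ∫ ω, tracePow (2 * p) (P k ω) ∂μ) ^ (p / (2 * p - 1)) *
        (∫ ω, tracePow (2 * p) (∑ k, P k ω) ∂μ) ^ ((p - 1) / (2 * p - 1)) := by
  have hH : ∀ k ω, (P k ω).IsHermitian := fun k ω => (hP k ω).1
  have h2p : 0 < 2 * p - 1 := by linarith
  have hs : 0 ≤ p / (2 * p - 1) := by positivity
  have ht : 0 ≤ (p - 1) / (2 * p - 1) := div_nonneg (by linarith) h2p.le
  have hst : p / (2 * p - 1) + (p - 1) / (2 * p - 1) = 1 := by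
    rw [← add_div, div_eq_one_iff_eq h2p.ne']; ring
  have i1 : Integrable (fun ω => ∑ k, tracePow (2 * p) (P k ω)) μ :=
    integrable_finsetSum _ fun k _ => hi k
  have i2 : Integrable (fun ω => tracePow (2 * p) (∑ k, P k ω)) μ :=
    integrable_tracePow_sum _ hm hH (by linarith) hi
  have n1 : ∀ ω, 0 ≤ ∑ k, tracePow (2 * p) (P k ω) := fun ω =>
    Finset.sum_nonneg fun k _ => tracePow_nonneg (hH k ω) _
  have n2 : ∀ ω, 0 ≤ tracePow (2 * p) (∑ k, P k ω) := fun ω =>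
    tracePow_nonneg (isHermitian_sum fun k _ => hH k ω) _
  have i3 : Integrable (fun ω => (∑ k, tracePow (2 * p) (P k ω)) ^ (p / (2 * p - 1)) *
      tracePow (2 * p) (∑ k, P k ω) ^ ((p - 1) / (2 * p - 1))) μ := by
    refine (i1.add i2).mono' ((i1.aemeasurable.pow_const _).mul
      (i2.aemeasurable.pow_const _)).aestronglyMeasurable (Filter.Eventually.of_forall fun ω => ?_)
    rw [Real.norm_eq_abs, abs_of_nonneg (mul_nonneg (Real.rpow_nonneg (n1 ω) _)
      (Real.rpow_nonneg (n2 ω) _))]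
    exact rpow_mul_rpow_le_add (n1 ω) (n2 ω) hs ht hst
  have i4 : Integrable (fun ω => tracePow p (∑ k, P k ω ^ 2)) μ :=
    integrable_tracePow_sum (A := fun k ω => P k ω ^ 2) _ (fun k => (hm k).pow_const 2)
      (fun k ω => (hH k ω).pow 2) hp fun k => integrable_tracePow_sq (hH k) (hi k)
  rw [← integral_finsetSum _ fun k _ => hi k]
  exact (integral_mono i4 i3 fun ω => tracePow_sum_sq_le _ (fun k => hP k ω) hp).trans
    (integral_rpow_mul_rpow_le i1 i2 n1 n2 hs ht hst)

/-- A moment bound for a sum of independent random positive semidefinite matrices. -/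
lemma posSemidef_moment_le {P : ι → Ω → Matrix (Fin d) (Fin d) ℂ}
    (hm : ∀ k, Measurable (P k)) (hP : ∀ k ω, (P k ω).PosSemidef) (hind : iIndepFun P μ)
    (hp : p = 1 ∨ 3 / 2 ≤ p)
    (hi : ∀ k, Integrable (fun ω => tracePow (2 * p) (P k ω)) μ) :
    (∫ ω, tracePow (2 * p) (∑ k, P k ω) ∂μ) ^ (1 / (2 * p)) ≤
      tracePow (2 * p) (∑ k, matrixExpectation μ (P k)) ^ (1 / (2 * p)) +
        (4 * p - 2) * (∑ k, ∫ ω, tracePow (2 * p) (P k ω) ∂μ) ^ (1 / (2 * p)) := by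
  have hp1 : 1 ≤ p := by rcases hp with h | h <;> linarith
  have hH : ∀ k ω, (P k ω).IsHermitian := fun k ω => (hP k ω).1
  set S : Ω → Matrix (Fin d) (Fin d) ℂ := fun ω => ∑ k, P k ω with hSdef
  set Q : Ω → Matrix (Fin d) (Fin d) ℂ := fun ω => ∑ k, P k ω ^ 2 with hQdef
  set M := ∑ k, matrixExpectation μ (P k) with hMdef
  have hM : M.IsHermitian := isHermitian_sum fun k _ => isHermitian_matrixExpectation (hH k)
  have hmS : Measurable S := Finset.measurable_sum _ fun k _ => hm k
  have hmQ : Measurable Q := Finset.measurable_sum _ fun k _ => (hm k).pow_const 2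
  have hS : ∀ ω, (S ω).IsHermitian := fun ω => isHermitian_sum fun k _ => hH k ω
  have hQ : ∀ ω, (Q ω).IsHermitian := fun ω => isHermitian_sum fun k _ => (hH k ω).pow 2
  have hSi : Integrable (fun ω => tracePow (2 * p) (S ω)) μ :=
    integrable_tracePow_sum _ hm hH (by linarith) hi
  have hQi : Integrable (fun ω => tracePow p (Q ω)) μ :=
    integrable_tracePow_sum (A := fun k ω => P k ω ^ 2) _ (fun k => (hm k).pow_const 2)
      (fun k ω => (hH k ω).pow 2) hp1 fun k => integrable_tracePow_sq (hH k) (hi k)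
  set X := ∫ ω, tracePow (2 * p) (S ω) ∂μ with hX
  set Θ := ∑ k, ∫ ω, tracePow (2 * p) (P k ω) ∂μ with hΘ
  set N := ∫ ω, tracePow p (Q ω) ∂μ with hN
  have hX0 : 0 ≤ X := integral_nonneg fun ω => tracePow_nonneg (hS ω) _
  have hΘ0 : 0 ≤ Θ := Finset.sum_nonneg fun k _ => integral_nonneg fun ω =>
    tracePow_nonneg (hH k ω) _
  have hN0 : 0 ≤ N := integral_nonneg fun ω => tracePow_nonneg (hQ ω) _
  have hNle : N ≤ Θ ^ (p / (2 * p - 1)) * X ^ ((p - 1) / (2 * p - 1)) :=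
    integral_tracePow_sum_sq_le hm hP hp1 hi
  have hbase := integral_tracePow_sum_le hm hH hind hp hi
  have hfirst : ∫ ω, (M * cfc (signedPow (2 * p - 1)) (S ω)).trace.re ∂μ ≤
      tracePow (2 * p) M ^ (1 / (2 * p)) * X ^ ((2 * p - 1) / (2 * p)) :=
    integral_trace_const_mul_signedPow_le hM hmS hS hp1 hSi
  have hQ1 : ∫ ω, (Q ω * cfc (fun x : ℝ => |x| ^ (2 * p - 1 - 1)) (S ω)).trace.re ∂μ ≤
      N ^ (1 / p) * X ^ ((p - 1) / p) :=
    integral_trace_mul_rpow_le hmQ hmS hQ hS hSi hp1 hQi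
  have hQ2 := integral_prod_trace_mul_rpow_le hmQ hmS hQ hS hp1 hQi hSi
  have j1 : Integrable (fun x : Ω × Ω => (Q x.1 * cfc (fun x : ℝ => |x| ^ (2 * p - 1 - 1))
      (S x.1)).trace.re) (μ.prod μ) :=
    (integrable_trace_mul_rpow hmQ hmS hQ hS hSi hp1 hQi).comp_fst μ
  have j2 := integrable_prod_trace_mul_rpow hmQ hmS hQ hS hp1 hQi hSi
  have jk : ∀ k, Integrable (fun x : Ω × Ω => ((P k x.1 - P k x.2) ^ 2 *
      cfc (fun x : ℝ => |x| ^ (2 * p - 1 - 1)) (S x.1)).trace.re) (μ.prod μ) := fun k =>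
    integrable_prod_trace_sub_sq_mul_rpow (hm k) hmS (hH k) hS hp1 (hi k) hSi
  have hQtr : ∀ ω (F : Matrix (Fin d) (Fin d) ℂ), (Q ω * F).trace.re =
      ∑ k, (P k ω ^ 2 * F).trace.re := fun ω F => by
    rw [hQdef, Finset.sum_mul, Matrix.trace_sum, Complex.re_sum]
  -- The constant is `2` from `(P - P')² ≤ 2(P² + P'²)` times two, as `Q` and its independent copy
  -- obey the same Hölder bound. Multiplied by `(2p - 1)/2` it gives `4p - 2`.
  have hsecond : ∑ k, ∫ x : Ω × Ω, ((P k x.1 - P k x.2) ^ 2 *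
        cfc (fun x : ℝ => |x| ^ (2 * p - 1 - 1)) (S x.1)).trace.re ∂(μ.prod μ) ≤
      4 * (N ^ (1 / p) * X ^ ((p - 1) / p)) := by
    rw [← integral_finsetSum _ fun k _ => jk k]
    have hmono := integral_mono (integrable_finsetSum Finset.univ fun k _ => jk k)
      ((j1.add j2).const_mul 2) fun x => by
        have hpt : ∀ k, ((P k x.1 - P k x.2) ^ 2 *
            cfc (fun x : ℝ => |x| ^ (2 * p - 1 - 1)) (S x.1)).trace.re ≤
            2 * ((P k x.1 ^ 2 * cfc (fun x : ℝ => |x| ^ (2 * p - 1 - 1)) (S x.1)).trace.re +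
              (P k x.2 ^ 2 * cfc (fun x : ℝ => |x| ^ (2 * p - 1 - 1)) (S x.1)).trace.re) :=
          fun k => by
            have h := trace_sq_mul_cfc_nonneg ((hH k x.1).add (hH k x.2)) (hS x.1)
              (v := fun x : ℝ => |x| ^ (2 * p - 1 - 1)) (fun x => by positivity)
            have e : (P k x.1 + P k x.2) ^ 2 = P k x.1 ^ 2 + P k x.1 ^ 2 +
                (P k x.2 ^ 2 + P k x.2 ^ 2) - (P k x.1 - P k x.2) ^ 2 := by
              noncomm_ring
            simp only [e, Matrix.sub_mul, Matrix.add_mul, Matrix.trace_sub, Matrix.trace_add,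
              Complex.sub_re, Complex.add_re] at h
            linarith
        change _ ≤ 2 * ((Q x.1 * _).trace.re + (Q x.2 * _).trace.re)
        rw [hQtr, hQtr, ← Finset.sum_add_distrib, Finset.mul_sum]
        exact Finset.sum_le_sum fun k _ => hpt k
    refine hmono.trans ?_
    rw [integral_const_mul]
    have e1 : ∫ x : Ω × Ω, ((Q x.1 * cfc (fun x : ℝ => |x| ^ (2 * p - 1 - 1)) (S x.1)).trace.re +
        (Q x.2 * cfc (fun x : ℝ => |x| ^ (2 * p - 1 - 1)) (S x.1)).trace.re) ∂(μ.prod μ) =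
        ∫ ω, (Q ω * cfc (fun x : ℝ => |x| ^ (2 * p - 1 - 1)) (S ω)).trace.re ∂μ +
        ∫ x : Ω × Ω, (Q x.2 * cfc (fun x : ℝ => |x| ^ (2 * p - 1 - 1))
          (S x.1)).trace.re ∂(μ.prod μ) := by
      rw [integral_add j1 j2, integral_prod_fst fun ω =>
        (Q ω * cfc (fun x : ℝ => |x| ^ (2 * p - 1 - 1)) (S ω)).trace.re]
    have e2 := e1.trans_le (add_le_add hQ1 hQ2)
    calc _ ≤ 2 * (N ^ (1 / p) * X ^ ((p - 1) / p) + N ^ (1 / p) * X ^ ((p - 1) / p)) :=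
          mul_le_mul_of_nonneg_left e2 (by norm_num)
      _ = _ := by ring
  have hmain : X ≤ tracePow (2 * p) M ^ (1 / (2 * p)) * X ^ ((2 * p - 1) / (2 * p)) +
      (4 * p - 2) * (Θ ^ (p / (2 * p - 1)) * X ^ ((p - 1) / (2 * p - 1))) ^ (1 / p) *
        X ^ ((p - 1) / p) := by
    have h1 : N ^ (1 / p) * X ^ ((p - 1) / p) ≤
        (Θ ^ (p / (2 * p - 1)) * X ^ ((p - 1) / (2 * p - 1))) ^ (1 / p) * X ^ ((p - 1) / p) :=
      mul_le_mul_of_nonneg_right (Real.rpow_le_rpow hN0 hNle (by positivity))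
        (Real.rpow_nonneg hX0 _)
    have h2 := mul_le_mul_of_nonneg_left (hsecond.trans (mul_le_mul_of_nonneg_left h1
      (by norm_num : (0 : ℝ) ≤ 4))) (by linarith : 0 ≤ (2 * p - 1) / 2)
    have h3 := hbase.trans (add_le_add hfirst h2)
    refine h3.trans (le_of_eq ?_)
    ring
  exact rpow_le_of_interpolated_self_bound hp1 hX0 (Real.rpow_nonneg (tracePow_nonneg hM _) _)
    hΘ0 hmain

/-- On expanding the square, both cross terms are linear in the copy of `Y`, which is centered and
independent of everything else, so they integrate to zero. -/
lemma integral_prod_trace_sub_sq_mul_rpow {Y S : Ω → Matrix (Fin d) (Fin d) ℂ}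
    (hmY : Measurable Y) (hmS : Measurable S)
    (hY : ∀ ω, (Y ω).IsHermitian) (hS : ∀ ω, (S ω).IsHermitian) (hp : 1 ≤ p)
    (hYi : Integrable (fun ω => tracePow (2 * p) (Y ω)) μ)
    (hSi : Integrable (fun ω => tracePow (2 * p) (S ω)) μ)
    (h0 : matrixExpectation μ Y = 0) :
    ∫ x : Ω × Ω, ((Y x.1 - Y x.2) ^ 2 *
        cfc (fun x : ℝ => |x| ^ (2 * p - 1 - 1)) (S x.1)).trace.re ∂(μ.prod μ) =
      ∫ ω, (Y ω ^ 2 * cfc (fun x : ℝ => |x| ^ (2 * p - 1 - 1)) (S ω)).trace.re ∂μ +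
      ∫ ω, (matrixExpectation μ (fun ω => Y ω ^ 2) *
        cfc (fun x : ℝ => |x| ^ (2 * p - 1 - 1)) (S ω)).trace.re ∂μ := by
  set g : Matrix (Fin d) (Fin d) ℂ → Matrix (Fin d) (Fin d) ℂ :=
    cfc (fun x : ℝ => |x| ^ (2 * p - 1 - 1)) with hg
  have hm2 : Measurable fun ω => Y ω ^ 2 := hmY.pow_const 2
  have hH2 : ∀ ω, (Y ω ^ 2).IsHermitian := fun ω => (hY ω).pow 2
  have hY2 := integrable_tracePow_sq hY hYi
  have i0 := integrable_prod_trace_sub_sq_mul_rpow hmY hmS hY hS hp hYi hSi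
  have i1 : Integrable (fun x : Ω × Ω => (Y x.1 ^ 2 * g (S x.1)).trace.re) (μ.prod μ) :=
    (integrable_trace_mul_rpow hm2 hmS hH2 hS hSi hp hY2).comp_fst μ
  have i2 : Integrable (fun x : Ω × Ω => (Y x.2 ^ 2 * g (S x.1)).trace.re) (μ.prod μ) :=
    integrable_prod_trace_mul_rpow (Q := fun ω => Y ω ^ 2) (S := S) hm2 hmS hH2 hS hp hY2 hSi
  -- The two cross terms are kept together: their sum is a combination of three functions already
  -- known to be integrable.
  have hpt : ∀ x : Ω × Ω, (Y x.2 * (g (S x.1) * Y x.1 + Y x.1 * g (S x.1))).trace.re =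
      (Y x.1 ^ 2 * g (S x.1)).trace.re + (Y x.2 ^ 2 * g (S x.1)).trace.re -
        ((Y x.1 - Y x.2) ^ 2 * g (S x.1)).trace.re := fun x => by
    have e : (Y x.1 - Y x.2) ^ 2 * g (S x.1) = Y x.1 ^ 2 * g (S x.1) -
        Y x.1 * (Y x.2 * g (S x.1)) - Y x.2 * (Y x.1 * g (S x.1)) + Y x.2 ^ 2 * g (S x.1) := by
      noncomm_ring
    rw [e, Matrix.mul_add, Matrix.trace_add, Matrix.trace_add, Matrix.trace_sub, Matrix.trace_sub,
      Matrix.trace_mul_comm (Y x.1), Matrix.mul_assoc (Y x.2)]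
    simp only [Complex.add_re, Complex.sub_re]
    ring
  have i3 : Integrable (fun x : Ω × Ω =>
      (Y x.2 * (g (S x.1) * Y x.1 + Y x.1 * g (S x.1))).trace.re) (μ.prod μ) := by
    simp only [hpt]
    exact (i1.add i2).sub i0
  have hYe : ∀ i j, Integrable (fun ω => Y ω i j) μ := integrable_entry hmY hY (by linarith) hYi
  have hY2e : ∀ i j, Integrable (fun ω => (Y ω ^ 2) i j) μ := integrable_entry hm2 hH2 hp hY2
  have hcross : ∫ x : Ω × Ω, (Y x.2 * (g (S x.1) * Y x.1 + Y x.1 * g (S x.1))).trace.re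
      ∂(μ.prod μ) = 0 := by
    have h := integral_prod_trace_mul (C := Y)
      (D := fun ω => g (S ω) * Y ω + Y ω * g (S ω)) hYe i3
    rw [h, h0]
    simp
  have e2 : ∫ x : Ω × Ω, (Y x.2 ^ 2 * g (S x.1)).trace.re ∂(μ.prod μ) =
      ∫ ω, (matrixExpectation μ (fun ω => Y ω ^ 2) * g (S ω)).trace.re ∂μ :=
    integral_prod_trace_mul (C := fun ω => Y ω ^ 2) (D := fun ω => g (S ω)) hY2e i2
  have e1 : ∫ x : Ω × Ω, (Y x.1 ^ 2 * g (S x.1)).trace.re ∂(μ.prod μ) =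
      ∫ ω, (Y ω ^ 2 * g (S ω)).trace.re ∂μ :=
    integral_prod_fst fun ω => (Y ω ^ 2 * g (S ω)).trace.re
  simp only [hpt] at hcross
  have e3 := integral_sub (μ := μ.prod μ) (i1.add i2) i0
  have e4 := integral_add (μ := μ.prod μ) i1 i2
  simp only [Pi.add_apply] at e3
  rw [← e1, ← e2]
  linarith

/-- A moment bound for a sum of independent centered random Hermitian matrices. -/
lemma isHermitian_moment_le {Y : ι → Ω → Matrix (Fin d) (Fin d) ℂ}
    (hm : ∀ k, Measurable (Y k)) (hY : ∀ k ω, (Y k ω).IsHermitian) (hind : iIndepFun Y μ)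
    (hp : p = 1 ∨ 3 / 2 ≤ p)
    (hi : ∀ k, Integrable (fun ω => tracePow (4 * p) (Y k ω)) μ)
    (h0 : ∀ k, matrixExpectation μ (Y k) = 0) :
    (∫ ω, tracePow (4 * p) (∑ k, Y k ω) ∂μ) ^ (1 / (4 * p)) ≤
      √(4 * p - 1) * √(tracePow (2 * p) (∑ k, matrixExpectation μ (fun ω => Y k ω ^ 2)) ^
        (1 / (2 * p))) +
        (4 * p - 1) * (∑ k, ∫ ω, tracePow (4 * p) (Y k ω) ∂μ) ^ (1 / (4 * p)) := by
  have hp1 : 1 ≤ p := by rcases hp with h | h <;> linarith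
  rw [show 4 * p = 2 * (2 * p) by ring] at hi ⊢
  set q := 2 * p with hq
  have hq1 : 1 ≤ q := by linarith
  have hm2 : ∀ k, Measurable fun ω => Y k ω ^ 2 := fun k => (hm k).pow_const 2
  have hH2 : ∀ k ω, (Y k ω ^ 2).IsHermitian := fun k ω => (hY k ω).pow 2
  have hi2 : ∀ k, Integrable (fun ω => tracePow q (Y k ω ^ 2)) μ := fun k =>
    integrable_tracePow_sq (hY k) (hi k)
  set S : Ω → Matrix (Fin d) (Fin d) ℂ := fun ω => ∑ k, Y k ω with hSdef
  set Q : Ω → Matrix (Fin d) (Fin d) ℂ := fun ω => ∑ k, Y k ω ^ 2 with hQdef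
  set C := ∑ k, matrixExpectation μ (fun ω => Y k ω ^ 2) with hCdef
  have hC : C.IsHermitian := isHermitian_sum fun k _ => isHermitian_matrixExpectation (hH2 k)
  have hmS : Measurable S := Finset.measurable_sum _ fun k _ => hm k
  have hmQ : Measurable Q := Finset.measurable_sum _ fun k _ => hm2 k
  have hS : ∀ ω, (S ω).IsHermitian := fun ω => isHermitian_sum fun k _ => hY k ω
  have hQ : ∀ ω, (Q ω).IsHermitian := fun ω => isHermitian_sum fun k _ => hH2 k ω
  have hSi : Integrable (fun ω => tracePow (2 * q) (S ω)) μ :=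
    integrable_tracePow_sum _ hm hY (by linarith) hi
  have hQi : Integrable (fun ω => tracePow q (Q ω)) μ :=
    integrable_tracePow_sum _ hm2 hH2 hq1 hi2
  set X := ∫ ω, tracePow (2 * q) (S ω) ∂μ with hX
  set T := ∑ k, ∫ ω, tracePow (2 * q) (Y k ω) ∂μ with hT
  set c := tracePow q C ^ (1 / q) with hc
  have hX0 : 0 ≤ X := integral_nonneg fun ω => tracePow_nonneg (hS ω) _
  have hT0 : 0 ≤ T := Finset.sum_nonneg fun k _ => integral_nonneg fun ω =>
    tracePow_nonneg (hY k ω) _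
  have hc0 : 0 ≤ c := Real.rpow_nonneg (tracePow_nonneg hC _) _
  have hXp := Real.rpow_nonneg hX0 ((q - 1) / q)
  -- The positive semidefinite bound is applied to the squares `Y_k²`; the condition `p = 1` or `p ≥
  -- 3/2` enters here.
  have hN : (∫ ω, tracePow q (Q ω) ∂μ) ^ (1 / q) ≤ c + (4 * p - 2) * T ^ (1 / q) := by
    have hpsd : ∀ k ω, (Y k ω ^ 2).PosSemidef := fun k ω => by
      have := Matrix.posSemidef_conjTranspose_mul_self (Y k ω)
      rwa [(hY k ω).eq, ← sq] at this
    have hind2 : iIndepFun (fun k ω => Y k ω ^ 2) μ :=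
      hind.comp (fun _ A => A ^ 2) fun _ => measurable_id.pow_const 2
    have h := posSemidef_moment_le hm2 hpsd hind2 hp hi2
    have e : ∀ k, ∫ ω, tracePow (2 * p) (Y k ω ^ 2) ∂μ = ∫ ω, tracePow (2 * q) (Y k ω) ∂μ :=
      fun k => integral_congr_ae (Filter.Eventually.of_forall fun ω => tracePow_sq (hY k ω) _)
    simp only [e] at h
    exact h
  -- The exchange estimate is taken at `q = 2p ≥ 2`, which always lies in the range of convexity.
  have hbase := integral_tracePow_sum_le hm hY hind (Or.inr (by linarith : 3 / 2 ≤ q)) hi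
  simp only [h0, Finset.sum_const_zero, Matrix.zero_mul, Matrix.trace_zero, Complex.zero_re,
    integral_zero, zero_add] at hbase
  have hcross := fun k => integral_prod_trace_sub_sq_mul_rpow (hm k) hmS (hY k) hS hq1 (hi k) hSi
    (h0 k)
  have j1 : ∀ k, Integrable (fun ω => (Y k ω ^ 2 *
      cfc (fun x : ℝ => |x| ^ (2 * q - 1 - 1)) (S ω)).trace.re) μ := fun k =>
    integrable_trace_mul_rpow (hm2 k) hmS (hH2 k) hS hSi hq1 (hi2 k)
  have j2 : ∀ k, Integrable (fun ω => (matrixExpectation μ (fun ω => Y k ω ^ 2) *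
      cfc (fun x : ℝ => |x| ^ (2 * q - 1 - 1)) (S ω)).trace.re) μ := fun k =>
    integrable_trace_mul_rpow (A := fun _ : Ω => matrixExpectation μ (fun ω => Y k ω ^ 2))
      measurable_const hmS (fun _ => isHermitian_matrixExpectation (hH2 k)) hS hSi hq1
      (integrable_const _)
  have hsum : ∑ k, ∫ x : Ω × Ω, ((Y k x.1 - Y k x.2) ^ 2 *
        cfc (fun x : ℝ => |x| ^ (2 * q - 1 - 1)) (S x.1)).trace.re ∂(μ.prod μ) =
      ∫ ω, (Q ω * cfc (fun x : ℝ => |x| ^ (2 * q - 1 - 1)) (S ω)).trace.re ∂μ +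
      ∫ ω, (C * cfc (fun x : ℝ => |x| ^ (2 * q - 1 - 1)) (S ω)).trace.re ∂μ := by
    simp only [hcross, Finset.sum_add_distrib, hQdef, hCdef, Finset.sum_mul, Matrix.trace_sum,
      Complex.re_sum]
    rw [integral_finsetSum _ fun k _ => j1 k, integral_finsetSum _ fun k _ => j2 k]
  have hQ1 : ∫ ω, (Q ω * cfc (fun x : ℝ => |x| ^ (2 * q - 1 - 1)) (S ω)).trace.re ∂μ ≤
      (c + (4 * p - 2) * T ^ (1 / q)) * X ^ ((q - 1) / q) :=
    (integral_trace_mul_rpow_le hmQ hmS hQ hS hSi hq1 hQi).trans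
      (mul_le_mul_of_nonneg_right hN hXp)
  have hC1 : ∫ ω, (C * cfc (fun x : ℝ => |x| ^ (2 * q - 1 - 1)) (S ω)).trace.re ∂μ ≤
      c * X ^ ((q - 1) / q) :=
    integral_trace_const_mul_rpow_le hC hmS hS hq1 hSi
  have hmain : X ≤ (2 * q - 1) / 2 * ((c + (4 * p - 2) * T ^ (1 / q)) * X ^ ((q - 1) / q) +
      c * X ^ ((q - 1) / q)) :=
    hbase.trans (mul_le_mul_of_nonneg_left (hsum.trans_le (add_le_add hQ1 hC1)) (by linarith))
  have h2q : 2 * q = 4 * p := by rw [hq]; ring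
  rw [h2q] at hmain ⊢
  exact rpow_le_of_self_bound hp1 hX0 hc0 hT0 hmain

end Moments

/-! ### Schatten norms and almost sure hypotheses. -/

section Schatten
variable {d : ℕ}

lemma schattenNorm_eq_tracePow {A : Matrix (Fin d) (Fin d) ℂ} (hA : A.IsHermitian) (q : ℝ) :
    schattenNorm q A = tracePow q A ^ (1 / q) := by
  rw [schattenNorm, cfcAbs_rpow_eq hA, tracePow]

lemma schattenNorm_rpow_eq_tracePow {A : Matrix (Fin d) (Fin d) ℂ} (hA : A.IsHermitian) {q : ℝ}
    (hq : q ≠ 0) : schattenNorm q A ^ q = tracePow q A := by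
  rw [schattenNorm_eq_tracePow hA, ← Real.rpow_mul (tracePow_nonneg hA q), one_div_mul_cancel hq,
    Real.rpow_one]

lemma schattenNorm_sqrt {C : Matrix (Fin d) (Fin d) ℂ} (hC : C.PosSemidef) {p : ℝ} (hp : 0 < p) :
    schattenNorm (4 * p) (CFC.sqrt C) = √(tracePow (2 * p) C ^ (1 / (2 * p))) := by
  have h0 : 0 ≤ C := Matrix.nonneg_iff_posSemidef.2 hC
  have hH : (CFC.sqrt C).IsHermitian := (Matrix.nonneg_iff_posSemidef.1 (CFC.sqrt_nonneg C)).1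
  have hsq : CFC.sqrt C ^ 2 = C := by rw [sq, CFC.sqrt_mul_sqrt_self C h0]
  have hT := tracePow_nonneg hC.1 (2 * p)
  rw [schattenNorm_eq_tracePow hH, show 4 * p = 2 * (2 * p) by ring, ← tracePow_sq hH, hsq,
    Real.sqrt_eq_rpow, ← Real.rpow_mul hT]
  congr 1
  field_simp

lemma measurableSet_posSemidef :
    MeasurableSet {A : Matrix (Fin d) (Fin d) ℂ | A.PosSemidef} := by
  have : {A : Matrix (Fin d) (Fin d) ℂ | A.PosSemidef} =
      {A | A.IsHermitian} ∩ ⋂ x : Fin d → ℂ, {A | 0 ≤ star x ⬝ᵥ A.mulVec x} := by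
    ext A
    simp only [Set.mem_inter_iff, Set.mem_iInter]
    exact Matrix.posSemidef_iff_dotProduct_mulVec
  rw [this]
  -- The intersection is uncountable, so closedness is used rather than measurability of each set.
  refine measurableSet_isHermitian.inter (isClosed_iInter fun x => ?_).measurableSet
  exact isClosed_le continuous_const
    (continuous_const.dotProduct (continuous_id.matrix_mulVec continuous_const))

variable {Ω : Type*} [MeasurableSpace Ω] {μ : Measure Ω} {ι : Type*} [Fintype ι]

open Classical in
/-- A family of random matrices lying almost surely in a measurable set that contains zero can be
modified on a null set so that it lies there surely. -/
lemma exists_modification {E : Set (Matrix (Fin d) (Fin d) ℂ)} (hE : MeasurableSet E)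
    (h0 : (0 : Matrix (Fin d) (Fin d) ℂ) ∈ E) {P : ι → Ω → Matrix (Fin d) (Fin d) ℂ}
    (hm : ∀ k, Measurable (P k)) (hind : iIndepFun P μ) (hP : ∀ k, ∀ᵐ ω ∂μ, P k ω ∈ E) :
    ∃ P' : ι → Ω → Matrix (Fin d) (Fin d) ℂ, (∀ k, Measurable (P' k)) ∧ iIndepFun P' μ ∧
      (∀ k ω, P' k ω ∈ E) ∧ ∀ᵐ ω ∂μ, ∀ k, P k ω = P' k ω := by
  -- One fixed measurable map is applied to every member of the family, so independence is
  -- preserved.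
  have hφ : Measurable fun A : Matrix (Fin d) (Fin d) ℂ => if A ∈ E then A else 0 :=
    Measurable.ite hE measurable_id measurable_const
  refine ⟨fun k ω => if P k ω ∈ E then P k ω else 0, fun k => hφ.comp (hm k),
    hind.comp (fun _ A => if A ∈ E then A else 0) fun _ => hφ, fun k ω => ?_, ?_⟩
  · by_cases h : P k ω ∈ E
    · simp [h]
    · simp [h, h0]
  · refine ae_all_iff.2 fun k => ?_
    filter_upwards [hP k] with ω hω
    simp [hω]

lemma matrixExpectation_congr {X Y : Ω → Matrix (Fin d) (Fin d) ℂ} (h : X =ᵐ[μ] Y) :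
    matrixExpectation μ X = matrixExpectation μ Y := by
  ext i j
  refine integral_congr_ae ?_
  filter_upwards [h] with ω hω
  rw [hω]

end Schatten

/-! ### The main theorem. -/

theorem mainTheorem7 {Ω : Type*} [MeasurableSpace Ω] (μ : Measure Ω) [IsProbabilityMeasure μ]
    {ι : Type*} [Fintype ι] (d : ℕ) (p : ℝ) (hp : p = 1 ∨ 3 / 2 ≤ p) :
    (∀ P : ι → Ω → Matrix (Fin d) (Fin d) ℂ,
      (∀ k, Measurable (P k)) →
      iIndepFun P μ →
      (∀ k, ∀ᵐ ω ∂μ, (P k ω).PosSemidef) →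
      (∀ k, Integrable (fun ω => schattenNorm (2 * p) (P k ω) ^ (2 * p)) μ) →
      Integrable (fun ω => schattenNorm (2 * p) (∑ k, P k ω) ^ (2 * p)) μ ∧
      (∫ ω, schattenNorm (2 * p) (∑ k, P k ω) ^ (2 * p) ∂μ) ^ (1 / (2 * p)) ≤
        (schattenNorm (2 * p) (∑ k, matrixExpectation μ (P k)) ^ (1 / 2 : ℝ) +
          √(4 * p - 2) *
            (∑ k, ∫ ω, schattenNorm (2 * p) (P k ω) ^ (2 * p) ∂μ) ^ (1 / (4 * p))) ^ 2) ∧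
    (∀ Y : ι → Ω → Matrix (Fin d) (Fin d) ℂ,
      (∀ k, Measurable (Y k)) →
      iIndepFun Y μ →
      (∀ k, ∀ᵐ ω ∂μ, (Y k ω).IsHermitian) →
      (∀ k, Integrable (fun ω => schattenNorm (4 * p) (Y k ω) ^ (4 * p)) μ) →
      (∀ k, matrixExpectation μ (Y k) = 0) →
      Integrable (fun ω => schattenNorm (4 * p) (∑ k, Y k ω) ^ (4 * p)) μ ∧
      (∫ ω, schattenNorm (4 * p) (∑ k, Y k ω) ^ (4 * p) ∂μ) ^ (1 / (4 * p)) ≤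
        √(4 * p - 1) *
            schattenNorm (4 * p)
              (CFC.sqrt (∑ k, matrixExpectation μ (fun ω => Y k ω ^ 2))) +
          (4 * p - 1) *
            (∑ k, ∫ ω, schattenNorm (4 * p) (Y k ω) ^ (4 * p) ∂μ) ^ (1 / (4 * p))) := by

  have hp1 : 1 ≤ p := by rcases hp with h | h <;> linarith
  constructor
  · intro P hm hind hP hi
    obtain ⟨P', hm', hind', hP', hae⟩ := exists_modification (E := {A | A.PosSemidef})
      measurableSet_posSemidef Matrix.PosSemidef.zero hm hind hP
    have hH : ∀ k ω, (P' k ω).IsHermitian := fun k ω => (hP' k ω).1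
    have hHS : ∀ ω, (∑ k, P' k ω).IsHermitian := fun ω => isHermitian_sum fun k _ => hH k ω
    have h2p : 2 * p ≠ 0 := by linarith
    have ek : ∀ k, (fun ω => schattenNorm (2 * p) (P k ω) ^ (2 * p)) =ᵐ[μ]
        fun ω => tracePow (2 * p) (P' k ω) := fun k => by
      filter_upwards [hae] with ω hω
      rw [hω k, schattenNorm_rpow_eq_tracePow (hH k ω) h2p]
    have eS : (fun ω => schattenNorm (2 * p) (∑ k, P k ω) ^ (2 * p)) =ᵐ[μ]
        fun ω => tracePow (2 * p) (∑ k, P' k ω) := by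
      filter_upwards [hae] with ω hω
      rw [Finset.sum_congr rfl fun k _ => hω k, schattenNorm_rpow_eq_tracePow (hHS ω) h2p]
    have eM : ∀ k, matrixExpectation μ (P k) = matrixExpectation μ (P' k) := fun k =>
      matrixExpectation_congr (hae.mono fun ω hω => hω k)
    have hi' : ∀ k, Integrable (fun ω => tracePow (2 * p) (P' k ω)) μ := fun k =>
      (hi k).congr (ek k)
    refine ⟨(integrable_tracePow_sum _ hm' hH (by linarith) hi').congr eS.symm, ?_⟩
    have hM : (∑ k, matrixExpectation μ (P' k)).IsHermitian :=
      isHermitian_sum fun k _ => isHermitian_matrixExpectation (hH k)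
    rw [integral_congr_ae eS, Finset.sum_congr rfl fun k _ => integral_congr_ae (ek k),
      Finset.sum_congr rfl fun k _ => eM k, schattenNorm_eq_tracePow hM]
    have hT : 0 ≤ ∑ k, ∫ ω, tracePow (2 * p) (P' k ω) ∂μ :=
      Finset.sum_nonneg fun k _ => integral_nonneg fun ω => tracePow_nonneg (hH k ω) _
    refine (posSemidef_moment_le hm' hP' hind' hp hi').trans ?_
    have hm0 := Real.rpow_nonneg (tracePow_nonneg hM (2 * p)) (1 / (2 * p))
    set m := tracePow (2 * p) (∑ k, matrixExpectation μ (P' k)) ^ (1 / (2 * p))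
    set T := ∑ k, ∫ ω, tracePow (2 * p) (P' k ω) ∂μ
    have e1 : T ^ (1 / (2 * p)) = (T ^ (1 / (4 * p))) ^ 2 := by
      rw [← Real.rpow_natCast, ← Real.rpow_mul hT]
      congr 1
      push_cast
      field_simp
      norm_num
    -- The moment bound already proved is the expanded square without its cross term, which is
    -- nonnegative.
    rw [← Real.sqrt_eq_rpow, add_sq, Real.sq_sqrt hm0, mul_pow,
      Real.sq_sqrt (by linarith : 0 ≤ 4 * p - 2), e1]
    have : 0 ≤ 2 * √m * (√(4 * p - 2) * T ^ (1 / (4 * p))) :=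
      mul_nonneg (by positivity) (mul_nonneg (Real.sqrt_nonneg _) (Real.rpow_nonneg hT _))
    linarith
  · intro Y hm hind hY hi h0
    obtain ⟨Y', hm', hind', hY', hae⟩ := exists_modification (E := {A | A.IsHermitian})
      measurableSet_isHermitian Matrix.isHermitian_zero hm hind hY
    have hH : ∀ k ω, (Y' k ω).IsHermitian := hY'
    have hHS : ∀ ω, (∑ k, Y' k ω).IsHermitian := fun ω => isHermitian_sum fun k _ => hH k ω
    have h4p : 4 * p ≠ 0 := by linarith
    have ek : ∀ k, (fun ω => schattenNorm (4 * p) (Y k ω) ^ (4 * p)) =ᵐ[μ]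
        fun ω => tracePow (4 * p) (Y' k ω) := fun k => by
      filter_upwards [hae] with ω hω
      rw [hω k, schattenNorm_rpow_eq_tracePow (hH k ω) h4p]
    have eS : (fun ω => schattenNorm (4 * p) (∑ k, Y k ω) ^ (4 * p)) =ᵐ[μ]
        fun ω => tracePow (4 * p) (∑ k, Y' k ω) := by
      filter_upwards [hae] with ω hω
      rw [Finset.sum_congr rfl fun k _ => hω k, schattenNorm_rpow_eq_tracePow (hHS ω) h4p]
    have eM : ∀ k, matrixExpectation μ (fun ω => Y k ω ^ 2) =
        matrixExpectation μ (fun ω => Y' k ω ^ 2) := fun k =>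
      matrixExpectation_congr (hae.mono fun ω hω => by simp only [hω k])
    have h0' : ∀ k, matrixExpectation μ (Y' k) = 0 := fun k => by
      rw [← h0 k]
      exact (matrixExpectation_congr (hae.mono fun ω hω => hω k)).symm
    have hi' : ∀ k, Integrable (fun ω => tracePow (4 * p) (Y' k ω)) μ := fun k =>
      (hi k).congr (ek k)
    refine ⟨(integrable_tracePow_sum _ hm' hH (by linarith) hi').congr eS.symm, ?_⟩
    have hpsd : (∑ k, matrixExpectation μ (fun ω => Y' k ω ^ 2)).PosSemidef := by
      refine Matrix.posSemidef_sum _ fun k _ => posSemidef_matrixExpectation ?_ fun ω => ?_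
      · refine integrable_entry (q := 2 * p) ((hm' k).pow_const 2) (fun ω => (hH k ω).pow 2)
          (by linarith) (integrable_tracePow_sq (hH k) ?_)
        rw [show 2 * (2 * p) = 4 * p by ring]
        exact hi' k
      · have := Matrix.posSemidef_conjTranspose_mul_self (Y' k ω)
        rwa [(hH k ω).eq, ← sq] at this
    rw [integral_congr_ae eS, Finset.sum_congr rfl fun k _ => integral_congr_ae (ek k),
      Finset.sum_congr rfl fun k _ => eM k, schattenNorm_sqrt hpsd (by linarith)]
    exact isHermitian_moment_le hm' hH hind' hp hi' h0'
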